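/- Let $P_4$ be the path on four vertices labelled $b - d - a - c$, and let $A(P_4)=\langle a,b,c,d \mid [b,d]=[d,a]=[a,c]=1\rangle$ be its right-angled Artin group. Let $M$ be a compact connected one-manifold, that is, $M=[0,1]$ or $M=S^1=\mathbb R/\mathbb Z$, and let $\mathrm{Diff}_+^{1+\mathrm{bv}}(M)$ be the group of orientation-preserving $C^1$ diffeomorphisms of $M$ whose first derivatives have bounded variation, with product $(fg)(x)=f(g(x))$. For $f\colon M\to M$ put $\mathrm{Fix} f=\{x\in M : f(x)=x\}$ and $\mathrm{supp} f=M\setminus \mathrm{Fix} f$, and for $Y\subseteq M$ let $\pi_0(Y)$ be the set of connected components of $Y$. Suppose that $\phi\colon A(P_4)\to \mathrm{Diff}_+^{1+\mathrm{bv}}(M)$ is an injective homomorphism such that $\mathrm{Fix}\,\phi(v)\neq\varnothing$ for each $v\in\{a,b,c,d\}$. Then there exist infinite collections of intervals $$\{I_a^j : j\ge 1\}\subseteq \pi_0(\mathrm{supp}\,\phi(a)),\qquad \{I_d^j : j\ge 1\}\subseteq \pi_0(\mathrm{supp}\,\phi(d))$$ such that (i) $I_v^j\neq I_v^k$ whenever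 $v\in\{a,d\}$ and $j\neq k$; (ii) for each $j$, $I_a^j\neq I_d^j$ and $\phi(cb)I_a^j\cap I_d^j\neq\varnothing$. -/

import Mathlib

open Set
open scoped commutatorElement

/-! ### Functions of bounded variation -/

/-- The derivative of a composition has bounded variation. -/
lemma bv_derivWithin_comp {s K K' : Set ℝ} {F G : ℝ → ℝ}
    (hF : ContDiffOn ℝ 1 F s) (hG : ContDiffOn ℝ 1 G s) (hGs : MapsTo G s s)
    (hmono : MonotoneOn G s) (hK : K ⊆ s) (hGK : MapsTo G K K')
    (hFb : BoundedVariationOn (derivWithin F s) K')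
    (hGb : BoundedVariationOn (derivWithin G s) K) :
    BoundedVariationOn (derivWithin (F ∘ G) s) K := by
  have h1 : BoundedVariationOn ((derivWithin F s) ∘ G) K :=
    ne_top_of_le_ne_top hFb (eVariationOn.comp_le_of_monotoneOn _ G (hmono.mono hK) hGK)
  have h2 := h1.smul hGb
  have h3 : EqOn (derivWithin (F ∘ G) s) ((derivWithin F s ∘ G) • derivWithin G s) K := by
    intro x hx
    have hx' := hK hx
    exact derivWithin_comp x (hF.differentiableOn one_ne_zero _ (hGs hx'))
      (hG.differentiableOn one_ne_zero _ hx') hGs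
  unfold BoundedVariationOn
  rw [eVariationOn.congr h3]
  exact h2

/-- The derivative of an inverse function has bounded variation. -/
lemma bv_derivWithin_inv {s K K' : Set ℝ} {F G : ℝ → ℝ} (hs : UniqueDiffOn ℝ s)
    (hF : ContDiffOn ℝ 1 F s) (hG : ContDiffOn ℝ 1 G s) (hGs : MapsTo G s s)
    (hFG : ∀ x ∈ s, F (G x) = x)
    (hmono : MonotoneOn G s) (hK : K ⊆ s) (hKc : IsCompact K) (hGK : MapsTo G K K')
    (hFb : BoundedVariationOn (derivWithin F s) K') :
    BoundedVariationOn (derivWithin G s) K := by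
  have h1 : BoundedVariationOn ((derivWithin F s) ∘ G) K :=
    ne_top_of_le_ne_top hFb (eVariationOn.comp_le_of_monotoneOn _ G (hmono.mono hK) hGK)
  have h2 : ∀ x ∈ s, derivWithin F s (G x) * derivWithin G s x = 1 := by
    intro x hx
    rw [← derivWithin_comp x (hF.differentiableOn one_ne_zero _ (hGs hx))
      (hG.differentiableOn one_ne_zero _ hx) hGs,
      show derivWithin (F ∘ G) s x = derivWithin id s x from
        derivWithin_congr (fun y hy => hFG y hy) (hFG x hx)]
    exact derivWithin_id x s (hs x hx)
  obtain ⟨C, hC⟩ := hKc.exists_bound_of_continuousOn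
    ((hG.continuousOn_derivWithin hs le_rfl).mono hK)
  have h4 : LipschitzOnWith (Real.toNNReal (C ^ 2)) (fun a : ℝ => a⁻¹)
      {a : ℝ | a ≠ 0 ∧ |a⁻¹| ≤ C} := by
    refine LipschitzOnWith.of_dist_le_mul ?_
    rintro a ⟨ha, ha'⟩ b ⟨hb, hb'⟩
    rw [Real.coe_toNNReal _ (sq_nonneg C), Real.dist_eq, Real.dist_eq]
    have : a⁻¹ - b⁻¹ = a⁻¹ * b⁻¹ * (b - a) := by field_simp
    rw [this, abs_mul, abs_mul, abs_sub_comm b a, sq]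
    have := abs_nonneg a⁻¹
    gcongr
    linarith
  have h5 : MapsTo ((derivWithin F s) ∘ G) K {a : ℝ | a ≠ 0 ∧ |a⁻¹| ≤ C} := by
    intro x hx
    have h := h2 x (hK hx)
    refine ⟨left_ne_zero_of_mul_eq_one h, ?_⟩
    rw [Function.comp_apply, ← eq_inv_of_mul_eq_one_right h]
    exact hC x hx
  have h6 := h4.comp_boundedVariationOn h5 h1
  have h7 : EqOn (derivWithin G s) ((fun a : ℝ => a⁻¹) ∘ ((derivWithin F s) ∘ G)) K :=
    fun x hx => eq_inv_of_mul_eq_one_right (h2 x (hK hx))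
  unfold BoundedVariationOn
  rw [eVariationOn.congr h7]
  exact h6

/-- A function of period one with bounded variation on `[0, 1]` has bounded variation on every
interval `[t, t + 1]`. -/
lemma bv_of_periodic {u : ℝ → ℝ} (hu : Function.Periodic u 1)
    (h : BoundedVariationOn u (Icc 0 1)) (t : ℝ) : BoundedVariationOn u (Icc t (t + 1)) := by
  have key : ∀ n : ℤ, BoundedVariationOn u (Icc (n : ℝ) (n + 1)) := by
    intro n
    have he : u = u ∘ fun x => x - n := by
      funext x
      simpa using (hu.sub_int_mul_eq n (x := x)).symm
    rw [he]
    refine ne_top_of_le_ne_top h (eVariationOn.comp_le_of_monotoneOn _ _ ?_ ?_)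
    · intro x _ y _ hxy
      simpa using hxy
    · rintro x ⟨h1, h2⟩
      exact ⟨by linarith, by linarith⟩
  have h1 := key ⌊t⌋
  have h2 := key (⌊t⌋ + 1)
  have h3 : BoundedVariationOn u (Icc (⌊t⌋ : ℝ) (⌊t⌋ + 1 + 1)) := by
    have := eVariationOn.Icc_add_Icc u (s := univ) (a := (⌊t⌋ : ℝ)) (b := ⌊t⌋ + 1)
      (c := ⌊t⌋ + 1 + 1) (by linarith) (by linarith) (mem_univ _)
    simp only [univ_inter] at this
    unfold BoundedVariationOn
    rw [← this]
    push_cast at h2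
    exact ENNReal.add_ne_top.2 ⟨h1, h2⟩
  refine h3.mono (Icc_subset_Icc (Int.floor_le t) ?_)
  linarith [Int.lt_floor_add_one t]

/-! ### Diffeomorphisms of the interval -/

/-- The real function on `[0, 1]` underlying a self-map of the unit interval, extended to the
line by constants. Only its restriction to `[0, 1]` matters. -/
noncomputable def intervalFun (f : unitInterval → unitInterval) : ℝ → ℝ :=
  IccExtend (zero_le_one' ℝ) (fun x => (f x : ℝ))

lemma intervalFun_of_mem (f : unitInterval → unitInterval) {x : ℝ} (hx : x ∈ Icc (0 : ℝ) 1) :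
    intervalFun f x = f ⟨x, hx⟩ := IccExtend_of_mem _ _ hx

lemma intervalFun_mapsTo (f : unitInterval → unitInterval) :
    MapsTo (intervalFun f) (Icc 0 1) (Icc 0 1) := by
  intro x hx
  rw [intervalFun_of_mem f hx]
  exact (f _).2

lemma intervalFun_monotoneOn {f : unitInterval → unitInterval} (hf : Monotone f) :
    MonotoneOn (intervalFun f) (Icc 0 1) := by
  intro x hx y hy hxy
  rw [intervalFun_of_mem f hx, intervalFun_of_mem f hy]
  exact hf (show (⟨x, hx⟩ : unitInterval) ≤ ⟨y, hy⟩ from hxy)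

lemma intervalFun_comp (f g : unitInterval → unitInterval) :
    EqOn (intervalFun (f ∘ g)) (intervalFun f ∘ intervalFun g) (Icc 0 1) := by
  intro x hx
  rw [Function.comp_apply, intervalFun_of_mem g hx, intervalFun_of_mem (f ∘ g) hx,
    intervalFun_of_mem f (g _).2]
  rfl

/-- `f` is an orientation-preserving `C¹` diffeomorphism of `[0, 1]` whose derivative has bounded
variation (one-sided derivatives are taken at the endpoints). -/
structure IsIntervalDiffBV (f : unitInterval ≃ₜ unitInterval) : Prop where
  strictMono : StrictMono f
  contDiff : ContDiffOn ℝ 1 (intervalFun f) (Icc 0 1)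
  contDiff_symm : ContDiffOn ℝ 1 (intervalFun f.symm) (Icc 0 1)
  bv : BoundedVariationOn (derivWithin (intervalFun f) (Icc 0 1)) (Icc 0 1)

lemma strictMono_homeomorph_symm {f : unitInterval ≃ₜ unitInterval} (hf : StrictMono f) :
    StrictMono f.symm := by
  intro x y hxy
  rw [← hf.lt_iff_lt]
  simpa using hxy

lemma IsIntervalDiffBV.one : IsIntervalDiffBV 1 := by
  have h : EqOn (intervalFun (id : unitInterval → unitInterval)) id (Icc 0 1) := fun x hx => by
    rw [intervalFun_of_mem _ hx]; rfl
  have hc : ContDiffOn ℝ 1 (intervalFun (id : unitInterval → unitInterval)) (Icc 0 1) :=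
    contDiffOn_id.congr h
  refine ⟨strictMono_id, hc, hc, ?_⟩
  have h' : EqOn (derivWithin (intervalFun (id : unitInterval → unitInterval)) (Icc 0 1))
      (fun _ => 1) (Icc 0 1) := by
    intro x hx
    rw [derivWithin_congr h (h hx)]
    exact derivWithin_id x _ (uniqueDiffOn_Icc_zero_one x hx)
  have h0 : eVariationOn (derivWithin (intervalFun (id : unitInterval → unitInterval)) (Icc 0 1))
      (Icc 0 1) = 0 := by
    rw [eVariationOn.congr h']
    exact eVariationOn.constant_on (by
      rintro _ ⟨_, _, rfl⟩ _ ⟨_, _, rfl⟩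
      rfl)
  change eVariationOn (derivWithin (intervalFun (id : unitInterval → unitInterval)) (Icc 0 1))
    (Icc 0 1) ≠ ⊤
  rw [h0]
  exact ENNReal.zero_ne_top

lemma IsIntervalDiffBV.mul {f g : unitInterval ≃ₜ unitInterval} (hf : IsIntervalDiffBV f)
    (hg : IsIntervalDiffBV g) : IsIntervalDiffBV (f * g) := by
  have h := intervalFun_comp f g
  have h' := intervalFun_comp g.symm f.symm
  refine ⟨hf.strictMono.comp hg.strictMono, ?_, ?_, ?_⟩
  · exact (hf.contDiff.comp hg.contDiff (intervalFun_mapsTo g)).congr h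
  · exact (hg.contDiff_symm.comp hf.contDiff_symm (intervalFun_mapsTo f.symm)).congr h'
  · have hd : EqOn (derivWithin (intervalFun (f ∘ g)) (Icc 0 1))
        (derivWithin (intervalFun f ∘ intervalFun g) (Icc 0 1)) (Icc 0 1) :=
      fun x hx => derivWithin_congr h (h hx)
    change eVariationOn (derivWithin (intervalFun (f ∘ g)) (Icc 0 1)) (Icc 0 1) ≠ ⊤
    rw [eVariationOn.congr hd]
    exact bv_derivWithin_comp hf.contDiff hg.contDiff
      (intervalFun_mapsTo g) (intervalFun_monotoneOn hg.strictMono.monotone) Subset.rfl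
      (intervalFun_mapsTo g) hf.bv hg.bv

lemma IsIntervalDiffBV.inv {f : unitInterval ≃ₜ unitInterval} (hf : IsIntervalDiffBV f) :
    IsIntervalDiffBV f⁻¹ := by
  have hm := strictMono_homeomorph_symm hf.strictMono
  refine ⟨hm, hf.contDiff_symm, hf.contDiff, ?_⟩
  refine bv_derivWithin_inv uniqueDiffOn_Icc_zero_one hf.contDiff hf.contDiff_symm
    (intervalFun_mapsTo f.symm) ?_ (intervalFun_monotoneOn hm.monotone) Subset.rfl isCompact_Icc
    (intervalFun_mapsTo f.symm) hf.bv
  intro x hx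
  have h := intervalFun_comp f f.symm hx
  rw [Function.comp_apply] at h
  change intervalFun f (intervalFun f.symm x) = x
  rw [← h, intervalFun_of_mem _ hx]
  simp

/-! ### Diffeomorphisms of the circle -/

/-- `f` is an orientation-preserving `C¹` diffeomorphism of the circle `ℝ/ℤ` whose derivative has
bounded variation: it has an increasing lift `F : ℝ → ℝ` with `F (x + 1) = F x + 1` such that `F`
and its inverse (a lift of the inverse of `f`) are `C¹`, and the derivative of `F` (a function of
period one, which is the derivative of `f`) has finite total variation over a period. -/
def IsCircleDiffBV (f : UnitAddCircle ≃ₜ UnitAddCircle) : Prop :=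
  ∃ F : CircleDeg1Liftˣ, (∀ x : ℝ, ((F x : ℝ) : UnitAddCircle) = f (x : UnitAddCircle)) ∧
    ContDiff ℝ 1 F ∧ ContDiff ℝ 1 (F⁻¹ : CircleDeg1Liftˣ) ∧
    BoundedVariationOn (deriv F) (Icc 0 1)

lemma CircleDeg1Lift.deriv_periodic (F : CircleDeg1Lift) :
    Function.Periodic (deriv F) 1 := by
  intro x
  rw [← deriv_comp_add_const]
  have : (fun y => F (y + 1)) = fun y => F y + 1 := funext F.map_add_one
  rw [this, deriv_add_const]

lemma CircleDeg1Lift.mapsTo_Icc (F : CircleDeg1Lift) :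
    MapsTo F (Icc 0 1) (Icc (F 0) (F 0 + 1)) := by
  rintro x ⟨h0, h1⟩
  refine ⟨F.monotone h0, ?_⟩
  rw [← F.map_add_one, zero_add]
  exact F.monotone h1

lemma IsCircleDiffBV.one : IsCircleDiffBV 1 := by
  refine ⟨1, fun x => rfl, contDiff_id, ?_, ?_⟩
  · rw [inv_one]
    exact contDiff_id
  · have h0 : eVariationOn (deriv ((1 : CircleDeg1Liftˣ) : CircleDeg1Lift)) (Icc 0 1) = 0 := by
      refine eVariationOn.constant_on ?_
      rintro _ ⟨_, _, rfl⟩ _ ⟨_, _, rfl⟩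
      simp
    unfold BoundedVariationOn
    rw [h0]
    exact ENNReal.zero_ne_top

lemma IsCircleDiffBV.mul {f g : UnitAddCircle ≃ₜ UnitAddCircle} (hf : IsCircleDiffBV f)
    (hg : IsCircleDiffBV g) : IsCircleDiffBV (f * g) := by
  obtain ⟨F, hF, hF1, hF2, hF3⟩ := hf
  obtain ⟨G, hG, hG1, hG2, hG3⟩ := hg
  refine ⟨F * G, ?_, ?_, ?_, ?_⟩
  · intro x
    rw [Homeomorph.mul_apply, ← hG, ← hF]
    rfl
  · exact hF1.comp hG1
  · rw [mul_inv_rev]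
    exact hG2.comp hF2
  · have := bv_derivWithin_comp (s := univ) (K := Icc 0 1) hF1.contDiffOn
      hG1.contDiffOn (mapsTo_univ _ _) (G.val.monotone.monotoneOn _) (subset_univ _)
      G.val.mapsTo_Icc (by
        rw [derivWithin_univ]
        exact bv_of_periodic F.val.deriv_periodic hF3 _)
      (by rwa [derivWithin_univ])
    rwa [derivWithin_univ] at this

lemma IsCircleDiffBV.inv {f : UnitAddCircle ≃ₜ UnitAddCircle} (hf : IsCircleDiffBV f) :
    IsCircleDiffBV f⁻¹ := by
  obtain ⟨F, hF, hF1, hF2, hF3⟩ := hf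
  refine ⟨F⁻¹, ?_, hF2, ?_, ?_⟩
  · intro x
    rw [Homeomorph.inv_apply, Homeomorph.eq_symm_apply, ← hF,
      CircleDeg1Lift.units_apply_inv_apply]
  · rwa [inv_inv]
  · have := bv_derivWithin_inv (s := univ) (K := Icc 0 1) uniqueDiffOn_univ hF1.contDiffOn
      hF2.contDiffOn (mapsTo_univ _ _) (fun x _ => CircleDeg1Lift.units_apply_inv_apply F x)
      (((F⁻¹ : CircleDeg1Liftˣ) : CircleDeg1Lift).monotone.monotoneOn _) (subset_univ _)
      isCompact_Icc (CircleDeg1Lift.mapsTo_Icc _) (by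
        rw [derivWithin_univ]
        exact bv_of_periodic F.val.deriv_periodic hF3 _)
    rwa [derivWithin_univ] at this

/-! ### Compact connected one-manifolds and their diffeomorphism groups -/

/-- The two compact connected one-manifolds: the interval `[0, 1]` and the circle `ℝ/ℤ`. -/
inductive ConnectedOneManifold
  | interval
  | circle

namespace ConnectedOneManifold

/-- The underlying space. -/
abbrev Carrier : ConnectedOneManifold → Type
  | interval => unitInterval
  | circle => UnitAddCircle

noncomputable instance (M : ConnectedOneManifold) : TopologicalSpace M.Carrier :=
  match M with
  | interval => inferInstanceAs (TopologicalSpace unitInterval)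
  | circle => inferInstanceAs (TopologicalSpace UnitAddCircle)

/-- The group of orientation-preserving `C¹` diffeomorphisms of the interval or the circle whose
first derivatives have bounded variation. The product is composition, `(f * g) x = f (g x)`. -/
def DiffBV : (M : ConnectedOneManifold) → Subgroup (M.Carrier ≃ₜ M.Carrier)
  | interval =>
    { carrier := {f : unitInterval ≃ₜ unitInterval | IsIntervalDiffBV f}
      one_mem' := IsIntervalDiffBV.one
      mul_mem' := fun hf hg => IsIntervalDiffBV.mul hf hg
      inv_mem' := fun hf => IsIntervalDiffBV.inv hf }
  | circle =>
    { carrier := {f : UnitAddCircle ≃ₜ UnitAddCircle | IsCircleDiffBV f}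
      one_mem' := IsCircleDiffBV.one
      mul_mem' := fun hf hg => IsCircleDiffBV.mul hf hg
      inv_mem' := fun hf => IsCircleDiffBV.inv hf }

end ConnectedOneManifold

/-! ### Supports and connected components -/

/-- The (open) support of a self-map: the complement of the set of fixed points. -/
def openSupport {X : Type*} (f : X → X) : Set X := (Function.fixedPoints f)ᶜ

/-- The set of connected components of a subset of a topological space. -/
def componentsOf {X : Type*} [TopologicalSpace X] (Y : Set X) : Set (Set X) :=
  {C | ∃ x ∈ Y, C = connectedComponentIn Y x}

/-! ### Right-angled Artin groups -/

/-- The right-angled Artin group of a graph: generated by the vertices, subject to the relations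
that adjacent vertices commute. -/
abbrev RightAngledArtinGroup {V : Type*} (Γ : SimpleGraph V) : Type _ :=
  PresentedGroup {r : FreeGroup V | ∃ v w, Γ.Adj v w ∧ r = ⁅FreeGroup.of v, FreeGroup.of w⁆}

/-- The four vertices of the path `P₄`. -/
inductive P4Vertex
  | a
  | b
  | c
  | d

/-- The path `P₄` on four vertices, labelled `b — d — a — c`. -/
def pathP4 : SimpleGraph P4Vertex :=
  SimpleGraph.fromEdgeSet {s(P4Vertex.b, P4Vertex.d), s(P4Vertex.d, P4Vertex.a),
    s(P4Vertex.a, P4Vertex.c)}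

/-- The generator of `A(P₄)` given by a vertex. -/
def genP4 (v : P4Vertex) : RightAngledArtinGroup pathP4 := PresentedGroup.of v

/-! ### Commutation in free groups -/

/-! The action is moved to the line: interval maps are extended by the identity, and circle
generators are lifted to homeomorphisms with fixed points. Smoothness enters only through Kopell's
lemma (`kopellProperty_of_isRegularOn`): components of the supports of two commuting generators
coincide or are disjoint. Together with Hölder's theorem it shows that generators centralizing `g`
commute with each other on each component of the support of `g` (`KopellProperty.comm_of_commute`).

Call `z` a transition if it lies in a component `P` of the support of `a` and `c b z` lies in a
component `R ≠ P` of the support of `d`. Then `z`, `b z`, `c b z` run along a chain formed by `P`, a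
component of `b`, a component of `c`, and `R`, in which non-neighbours are disjoint. Either end of
the chain, with the direction of motion, determines the two middle intervals and confines `b z` to a
compact subset of the support of `c` (`exists_compact_of_a`, `exists_compact_of_d`).

Suppose finitely many `P` and `R` account for all transitions. Let `x = b a b⁻¹`, `y = c⁻¹ d c` and
`u = ⁅x, y⁆`. A point moved by both `x` and `y` is either `b z` for a transition `z`, or lies in a
common component of `a` and `d`, on which `x = a` and `y = d` commute. So the support of `u` lies in
a compact set free of global fixed points of `⟨b a b⁻¹, c, d⟩`. It meets only finitely many gaps of
the global fixed point set. In each gap some group element pushes the support off itself, so the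
commutator of `u` with the corresponding conjugate is trivial on that gap. Iteration produces an
element acting trivially (`exists_trivial_of_compact`). It is not the identity, because its image in
a free group of rank two, under the map `b a b⁻¹, c, d ↦ r, s, r`, stays nontrivial
(`foldHom_eq_one`). This contradicts faithfulness (`not_faithful_of_finite`), so transitions with a
new `P` and a new `R` can be chosen forever (`exists_transitions`).

On the circle this takes place between a global fixed point of the lifted action and its translate
by one. Such a point exists by the same commutator argument applied to the free group `⟨a, b⟩`
(`exists_globalFixed`). -/

lemma FreeGroup.eq_one_of_commute_of {α : Type*} {x y : α} (hxy : x ≠ y) {z : FreeGroup α}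
    (hx : Commute z (FreeGroup.of x)) (hy : Commute z (FreeGroup.of y)) : z = 1 := by
  classical
  by_contra hz
  -- If the reduced word of `z` did not begin with a power of `t`, the word of `t z` would be `t`
  -- followed by that of `z`. The word of `z t` is a sublist of that of `z` followed by `t`, of the
  -- same length, so the two lists agree and begin with the same letter.
  have key : ∀ t : α, Commute z (FreeGroup.of t) → ∀ l L, z.toWord = l :: L → l.1 = t := by
    intro t ht l L hL
    by_contra hne
    have hred : FreeGroup.IsReduced ((t, true) :: z.toWord) := by
      rw [hL, FreeGroup.isReduced_cons_cons]
      refine ⟨fun h => absurd h.symm hne, ?_⟩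
      rw [← hL]
      exact FreeGroup.isReduced_toWord
    have h1 : (FreeGroup.of t * z).toWord = (t, true) :: z.toWord := by
      rw [FreeGroup.toWord_mul, FreeGroup.toWord_of]
      exact hred.reduce_eq
    have h2 := FreeGroup.toWord_mul_sublist z (FreeGroup.of t)
    rw [ht.eq, h1, FreeGroup.toWord_of] at h2
    have h3 := h2.eq_of_length (by simp)
    rw [hL] at h3
    simp only [List.cons_append, List.cons.injEq] at h3
    exact hne (by rw [← h3.1])
  match hL : z.toWord with
  | [] => exact hz (FreeGroup.toWord_eq_nil_iff.1 hL)
  | l :: L => exact hxy ((key x hx l L hL).symm.trans (key y hy l L hL))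

lemma IsFreeGroup.isCyclic_of_central {G : Type*} [Group G] [IsFreeGroup G] {z : G} (hz : z ≠ 1)
    (h : ∀ x, Commute z x) : IsCyclic G := by
  let e := IsFreeGroup.toFreeGroup G
  have hsub : Subsingleton (IsFreeGroup.Generators G) := by
    refine ⟨fun x y => ?_⟩
    by_contra hxy
    have hc : ∀ w, Commute (e z) w := fun w => by
      have := (h (e.symm w)).map e
      rwa [e.apply_symm_apply] at this
    have := FreeGroup.eq_one_of_commute_of hxy (hc _) (hc _)
    exact hz (by simpa using this)
  have : IsCyclic (FreeGroup (IsFreeGroup.Generators G)) := by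
    rcases isEmpty_or_nonempty (IsFreeGroup.Generators G) with hE | ⟨⟨x⟩⟩
    · infer_instance
    · have := uniqueOfSubsingleton x
      infer_instance
  exact isCyclic_of_surjective e.symm e.symm.surjective

/-- The centralizer of `u` is free by Nielsen–Schreier and has the nontrivial central element `u`,
so it is cyclic. -/
lemma IsFreeGroup.exists_generator_centralizer {G : Type*} [Group G] [IsFreeGroup G] {u : G}
    (hu : u ≠ 1) : ∃ r, ∀ x, Commute x u → ∃ n : ℤ, r ^ n = x := by
  let C := Subgroup.centralizer {u}
  have hmem : ∀ x, x ∈ C ↔ Commute x u := fun x => by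
    rw [Subgroup.mem_centralizer_singleton_iff]
    exact Iff.rfl
  have hcyc : IsCyclic C := by
    refine IsFreeGroup.isCyclic_of_central (z := ⟨u, (hmem u).2 (Commute.refl u)⟩) ?_ ?_
    · simpa [Subtype.ext_iff] using hu
    · rintro ⟨x, hx⟩
      have := ((hmem x).1 hx).symm
      exact Subtype.ext this.eq
  obtain ⟨r, hr⟩ := hcyc.exists_generator
  refine ⟨r, fun x hx => ?_⟩
  obtain ⟨n, hn⟩ := Subgroup.mem_zpowers_iff.1 (hr ⟨x, (hmem x).2 hx⟩)
  exact ⟨n, by simpa [Subtype.ext_iff] using hn⟩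

lemma IsFreeGroup.commute_of_commute {G : Type*} [Group G] [IsFreeGroup G] {u x y : G}
    (hu : u ≠ 1) (hx : Commute x u) (hy : Commute y u) : Commute x y := by
  obtain ⟨r, hr⟩ := IsFreeGroup.exists_generator_centralizer hu
  obtain ⟨n, rfl⟩ := hr x hx
  obtain ⟨m, rfl⟩ := hr y hy
  exact (Commute.refl r).zpow_zpow n m

lemma IsFreeGroup.isMulTorsionFree {G : Type*} [Group G] [IsFreeGroup G] : IsMulTorsionFree G :=
  (IsFreeGroup.toFreeGroup G).injective.isMulTorsionFree (IsFreeGroup.toFreeGroup G).toMonoidHom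

/-- In a free group, an element commuting with one of its conjugates commutes with the conjugating
element. -/
lemma IsFreeGroup.commute_of_commute_conj {G : Type*} [Group G] [IsFreeGroup G] {u g : G}
    (h : Commute u (g * u * g⁻¹)) : Commute u g := by
  have := IsFreeGroup.isMulTorsionFree (G := G)
  rcases eq_or_ne u 1 with rfl | hu
  · exact Commute.one_left g
  obtain ⟨r, hr⟩ := IsFreeGroup.exists_generator_centralizer hu
  obtain ⟨k, hk⟩ := hr u (Commute.refl u)
  have hr1 : r ≠ 1 := by
    rintro rfl
    exact hu (by rw [← hk, one_zpow])
  have hru : Commute r u := by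
    rw [← hk]
    exact (Commute.refl r).zpow_right k
  -- Both `g r g⁻¹` and `u` commute with `g u g⁻¹ ≠ 1`, hence with each other, so `g r g⁻¹` lies in
  -- the cyclic centralizer of `u`.
  have hconj : ∀ g : G, Commute u (g * u * g⁻¹) → ∃ n : ℤ, r ^ n = g * r * g⁻¹ := by
    intro g hg
    refine hr _ (IsFreeGroup.commute_of_commute (u := g * u * g⁻¹) ?_ ?_ hg)
    · simpa using hu
    · exact (SemiconjBy.conj_iff).2 hru
  obtain ⟨n, hn⟩ := hconj g h
  obtain ⟨m, hm⟩ := hconj g⁻¹ (by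
    have := (SemiconjBy.conj_iff (b := g⁻¹)).2 h
    simp only [inv_inv] at this ⊢
    have h2 : g⁻¹ * (g * u * g⁻¹) * g = u := by group
    rw [h2] at this
    exact this.symm)
  rw [inv_inv] at hm
  have hnm : r ^ (n * m) = r ^ (1 : ℤ) := by
    rw [zpow_mul, hn, conj_zpow, hm]
    group
  -- Torsion-freeness gives `n m = 1`: conjugation by `g` fixes or inverts `r`.
  have hnm' : n * m = 1 := by
    by_contra hne
    refine hr1 (zpow_left_injective (sub_ne_zero.2 hne) ?_)
    simp only [one_zpow, zpow_sub, hnm, mul_inv_cancel]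
  rcases Int.eq_one_or_neg_one_of_mul_eq_one hnm' with rfl | rfl
  · have : Commute r g := by
      rw [zpow_one] at hn
      exact (mul_inv_eq_iff_eq_mul.1 hn.symm).symm
    rw [← hk]
    exact this.zpow_left k
  -- If `g` inverts `r`, then `g ^ 2` commutes with both `r` and `g`; commutation is transitive
  -- through a nontrivial element, so `r` and `g` commute.
  · have hn' : g * r = r⁻¹ * g := by
      rw [zpow_neg_one] at hn
      exact mul_inv_eq_iff_eq_mul.1 hn.symm
    have h2 : Commute r (g ^ 2) := by
      have : g * (g * r) = r * (g * g) := by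
        rw [hn', ← mul_assoc]
        have : g * r⁻¹ = r * g := by
          rw [mul_inv_eq_iff_eq_mul, mul_assoc, hn', mul_inv_cancel_left]
        rw [this, mul_assoc]
      rw [sq]
      change r * (g * g) = g * g * r
      rw [mul_assoc, this]
    rcases eq_or_ne (g ^ 2) 1 with h1 | h1
    · have : g = 1 := by
        rwa [pow_eq_one_iff_left two_ne_zero] at h1
      rw [this]
      exact Commute.one_right u
    · have : Commute r g :=
        IsFreeGroup.commute_of_commute h1 h2 ((Commute.refl g).pow_right 2)
      rw [← hk]
      exact this.zpow_left k

/-! ### Gaps of closed subsets of the line -/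

/-- `(p, q)` is a bounded connected component of the complement of `F`. -/
structure IsGap (F : Set ℝ) (p q : ℝ) : Prop where
  lt : p < q
  left_mem : p ∈ F
  right_mem : q ∈ F
  notMem : ∀ x ∈ Ioo p q, x ∉ F

lemma IsGap.exists_of_notMem {F : Set ℝ} (hF : IsClosed F) {x y z : ℝ} (hx : x ∉ F) (hy : y ∈ F)
    (hz : z ∈ F) (hyx : y ≤ x) (hxz : x ≤ z) :
    ∃ p q, IsGap F p q ∧ x ∈ Ioo p q ∧ y ≤ p ∧ q ≤ z := by
  obtain ⟨p, ⟨hpF, hp⟩, hp'⟩ := (isCompact_Icc.inter_left hF : IsCompact (F ∩ Icc y x)).exists_isGreatest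
    ⟨y, hy, le_rfl, hyx⟩
  obtain ⟨q, ⟨hqF, hq⟩, hq'⟩ := (isCompact_Icc.inter_left hF : IsCompact (F ∩ Icc x z)).exists_isLeast
    ⟨z, hz, hxz, le_rfl⟩
  have hpx : p < x := hp.2.lt_of_ne (by rintro rfl; exact hx hpF)
  have hxq : x < q := hq.1.lt_of_ne (by rintro rfl; exact hx hqF)
  refine ⟨p, q, ⟨hpx.trans hxq, hpF, hqF, ?_⟩, ⟨hpx, hxq⟩, hp.1, hq.2⟩
  rintro w ⟨hw1, hw2⟩ hwF
  rcases le_total w x with h | h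
  · exact (hp' ⟨hwF, hp.1.trans hw1.le, h⟩).not_gt hw1
  · exact (hq' ⟨hwF, h, hw2.le.trans hq.2⟩).not_gt hw2

lemma IsGap.left_le {F : Set ℝ} {p q p' x : ℝ} (h : IsGap F p q) (hp' : p' ∈ F)
    (hx : x ∈ Ioo p q) (hx' : p' ≤ x) : p' ≤ p := by
  by_contra! hlt
  exact h.notMem p' ⟨hlt, hx'.trans_lt hx.2⟩ hp'

lemma IsGap.le_right {F : Set ℝ} {p q q' x : ℝ} (h : IsGap F p q) (hq' : q' ∈ F)
    (hx : x ∈ Ioo p q) (hx' : x ≤ q') : q ≤ q' := by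
  by_contra! hlt
  exact h.notMem q' ⟨hx.1.trans_le hx', hlt⟩ hq'

lemma IsGap.eq_of_mem {F : Set ℝ} {p q p' q' x : ℝ} (h : IsGap F p q) (h' : IsGap F p' q')
    (hx : x ∈ Ioo p q) (hx' : x ∈ Ioo p' q') : p = p' ∧ q = q' :=
  ⟨le_antisymm (h'.left_le h.left_mem hx' hx.1.le)
      (h.left_le h'.left_mem hx hx'.1.le),
    le_antisymm (h.le_right h'.right_mem hx hx'.2.le) (h'.le_right h.right_mem hx' hx.2.le)⟩

/-! ### Order isomorphisms of the line -/

lemma OrderIso.inv_apply_eq_self_iff {f : ℝ ≃o ℝ} {x : ℝ} : f⁻¹ x = x ↔ f x = x := by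
  constructor <;> intro h
  · nth_rw 1 [← h]
    exact RelIso.apply_inv_self f x
  · nth_rw 1 [← h]
    exact RelIso.inv_apply_self f x

lemma OrderIso.lt_inv_apply_iff {f : ℝ ≃o ℝ} {x y : ℝ} : x < f⁻¹ y ↔ f x < y := by
  rw [← f.lt_iff_lt, RelIso.apply_inv_self]

lemma OrderIso.inv_apply_lt_iff {f : ℝ ≃o ℝ} {x y : ℝ} : f⁻¹ x < y ↔ x < f y := by
  rw [← f.lt_iff_lt, RelIso.apply_inv_self]

lemma OrderIso.le_inv_apply_iff {f : ℝ ≃o ℝ} {x y : ℝ} : x ≤ f⁻¹ y ↔ f x ≤ y := by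
  rw [← f.le_iff_le, RelIso.apply_inv_self]

lemma OrderIso.inv_apply_le_iff {f : ℝ ≃o ℝ} {x y : ℝ} : f⁻¹ x ≤ y ↔ x ≤ f y := by
  rw [← f.le_iff_le, RelIso.apply_inv_self]

lemma OrderIso.apply_mem_Ioo {f : ℝ ≃o ℝ} {p q x : ℝ} (hp : f p = p) (hq : f q = q)
    (hx : x ∈ Ioo p q) : f x ∈ Ioo p q := by
  constructor
  · rw [← hp]; exact f.lt_iff_lt.2 hx.1
  · rw [← hq]; exact f.lt_iff_lt.2 hx.2

lemma OrderIso.apply_mem_Icc {f : ℝ ≃o ℝ} {p q x : ℝ} (hp : f p = p) (hq : f q = q)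
    (hx : x ∈ Icc p q) : f x ∈ Icc p q := by
  constructor
  · rw [← hp]; exact f.le_iff_le.2 hx.1
  · rw [← hq]; exact f.le_iff_le.2 hx.2

/-- A commutator fixes every point outside the common support `Z` of the two maps and its images
under them. -/
lemma OrderIso.commutator_apply_of {f g : ℝ ≃o ℝ} {x : ℝ} (h : f x = x ∨ g x = x)
    (hf : f x = x ∨ g (f⁻¹ x) = f⁻¹ x) (hg : g x = x ∨ f (g⁻¹ x) = g⁻¹ x) :
    ⁅f, g⁆ x = x := by
  have e : ⁅f, g⁆ x = f (g (f⁻¹ (g⁻¹ x))) := rfl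
  rw [e]
  by_cases hgx : g x = x
  · rw [inv_apply_eq_self_iff.2 hgx]
    rcases hf with hf | hf
    · rw [inv_apply_eq_self_iff.2 hf, hgx, hf]
    · rw [hf, RelIso.apply_inv_self]
  · have hfx := h.resolve_right hgx
    have := hg.resolve_left hgx
    rw [inv_apply_eq_self_iff.2 this, RelIso.apply_inv_self, hfx]

/-- The set of global fixed points of an action on the line. -/
def globalFixed {Γ : Type*} [Group Γ] (ψ : Γ →* (ℝ ≃o ℝ)) : Set ℝ := {x | ∀ g, ψ g x = x}

lemma isClosed_globalFixed {Γ : Type*} [Group Γ] (ψ : Γ →* (ℝ ≃o ℝ)) :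
    IsClosed (globalFixed ψ) := by
  simp only [globalFixed, ofPred_forall]
  exact isClosed_iInter fun g => isClosed_eq (ψ g).continuous continuous_id

/-- A group without global fixed points on `(p, q)` moves points of `(p, q)` arbitrarily close to
the right endpoint. -/
lemma IsGap.exists_lt_apply {Γ : Type*} [Group Γ] {ψ : Γ →* (ℝ ≃o ℝ)} {p q l r : ℝ}
    (h : IsGap (globalFixed ψ) p q) (hl : p < l) (hr : r < q) : ∃ g, r < ψ g l := by
  by_contra! hle
  have hne : (range fun g => ψ g l).Nonempty := ⟨_, 1, rfl⟩
  have hb : BddAbove (range fun g => ψ g l) := ⟨r, by rintro _ ⟨g, rfl⟩; exact hle g⟩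
  -- If the orbit of `l` stayed below `r`, its supremum would be a global fixed point inside the
  -- gap.
  set s := sSup (range fun g => ψ g l) with hs
  have hsr : s ≤ r := csSup_le hne (by rintro _ ⟨g, rfl⟩; exact hle g)
  have hls : l ≤ s := by
    refine le_csSup hb ⟨1, ?_⟩
    simp
  have key : ∀ k, s ≤ ψ k s := by
    intro k
    refine csSup_le hne ?_
    rintro _ ⟨g, rfl⟩
    have : ψ (k⁻¹ * g) l ≤ s := le_csSup hb ⟨k⁻¹ * g, rfl⟩
    rw [map_mul, map_inv, RelIso.mul_apply, OrderIso.inv_apply_le_iff] at this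
    exact this
  refine h.notMem s ⟨hl.trans_le hls, hsr.trans_lt hr⟩ fun g => le_antisymm ?_ (key g)
  have := key g⁻¹
  rwa [map_inv, OrderIso.le_inv_apply_iff] at this

/-- Let `u` be an element supported, inside `[o, o']`, in finitely many compact intervals each of
which lies in a gap of the global fixed point set. Repeatedly replacing `u` by a commutator with
one of its conjugates gives an element acting trivially, which remains nontrivial in the free group
`Q`. -/
lemma exists_trivial_of_finset {Γ Q : Type*} [Group Γ] [Group Q] [IsFreeGroup Q]
    {ψ : Γ →* (ℝ ≃o ℝ)} {o o' : ℝ} (ho : o ∈ globalFixed ψ) (ho' : o' ∈ globalFixed ψ)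
    {ρ : Γ →* Q} {s t : Γ}
    (hst : ∀ z, Commute z (ρ s) → Commute z (ρ t) → z = 1) (L : Finset (ℝ × ℝ)) :
    (∀ P ∈ L, IsGap (globalFixed ψ) P.1 P.2) → ∀ u, ρ u ≠ 1 →
    (∀ x ∈ Icc o o', ψ u x ≠ x → ∃ P ∈ L, x ∈ Ioo P.1 P.2) →
    (∀ P ∈ L, ∃ l r, P.1 < l ∧ l ≤ r ∧ r < P.2 ∧
      ∀ x ∈ Ioo P.1 P.2, ψ u x ≠ x → x ∈ Icc l r) →
    ∃ u', ρ u' ≠ 1 ∧ ∀ x ∈ Icc o o', ψ u' x = x := by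
  classical
  induction L using Finset.induction_on with
  | empty =>
    intro _ u hu h _
    refine ⟨u, hu, fun x hx => ?_⟩
    by_contra hne
    obtain ⟨P, hP, -⟩ := h x hx hne
    simp at hP
  | insert P L hPL ih =>
    intro hL u hu hsupp hcpt
    have hP := hL P (Finset.mem_insert_self _ _)
    obtain ⟨l, r, hpl, hlr, hrq, hlrs⟩ := hcpt P (Finset.mem_insert_self _ _)
    have hr : r ∈ Ioo P.1 P.2 := ⟨hpl.trans_le hlr, hrq⟩
    have inv_mem : ∀ {p q x : ℝ} (g : Γ), p ∈ globalFixed ψ → q ∈ globalFixed ψ → x ∈ Ioo p q →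
        (ψ g)⁻¹ x ∈ Ioo p q := fun g hp hq hx => by
      rw [← map_inv]
      exact OrderIso.apply_mem_Ioo (hp _) (hq _) hx
    -- The bound is chosen so that `g₀`, `s g₀` and `t g₀` all carry `l` past `r`. If `ρ u` commuted
    -- with the images of all three, it would commute with `ρ s` and `ρ t` and be trivial.
    obtain ⟨g₀, hg₀⟩ := hP.exists_lt_apply (l := l) (r := max r (max ((ψ s)⁻¹ r) ((ψ t)⁻¹ r))) hpl
      (max_lt hrq (max_lt (inv_mem s hP.left_mem hP.right_mem hr).2
        (inv_mem t hP.left_mem hP.right_mem hr).2))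
    simp only [max_lt_iff, OrderIso.inv_apply_lt_iff] at hg₀
    obtain ⟨g, hgr, hgu⟩ : ∃ g, r < ψ g l ∧ ¬ Commute (ρ u) (ρ g) := by
      by_contra! hall
      have h0 := hall g₀ hg₀.1
      refine hu (hst _ ?_ ?_)
      · have := (hall (s * g₀) (by rw [map_mul]; exact hg₀.2.1)).mul_right h0.inv_right
        simpa using this
      · have := (hall (t * g₀) (by rw [map_mul]; exact hg₀.2.2)).mul_right h0.inv_right
        simpa using this
    have hconj : ∀ x, ψ (g * u * g⁻¹) x ≠ x → ψ u ((ψ g)⁻¹ x) ≠ (ψ g)⁻¹ x := by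
      intro x hx he
      refine hx ?_
      simp only [map_mul, map_inv, RelIso.mul_apply, he, RelIso.apply_inv_self]
    have hmoved : ∀ x, ψ ⁅u, g * u * g⁻¹⁆ x ≠ x →
        ψ u x ≠ x ∨ ψ u ((ψ g)⁻¹ x) ≠ (ψ g)⁻¹ x := by
      intro x hx
      by_contra! hcon
      refine hx ?_
      rw [map_commutatorElement]
      exact OrderIso.commutator_apply_of (Or.inl hcon.1) (Or.inl hcon.1)
        (Or.inl (by by_contra h; exact hconj x h hcon.2))
    -- Inside this gap `g` carries `[l, r]` off itself, so `u` and its conjugate have disjoint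
    -- supports there.
    have htriv : ∀ x ∈ Ioo P.1 P.2, ψ ⁅u, g * u * g⁻¹⁆ x = x := by
      have hdisj : ∀ x ∈ Ioo P.1 P.2, ψ u x = x ∨ ψ (g * u * g⁻¹) x = x := by
        intro x hx
        by_contra! hcon
        have h1 := hlrs x hx hcon.1
        have h2 := hlrs _ (inv_mem g hP.left_mem hP.right_mem hx) (hconj x hcon.2)
        rw [mem_Icc, OrderIso.le_inv_apply_iff] at h2
        exact absurd (h2.1.trans h1.2) (not_le.2 hgr)
      intro x hx
      rw [map_commutatorElement]
      refine OrderIso.commutator_apply_of (hdisj x hx) ?_ ?_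
      · rcases hdisj _ (inv_mem u hP.left_mem hP.right_mem hx) with h | h
        · left
          rw [RelIso.apply_inv_self] at h
          exact OrderIso.inv_apply_eq_self_iff.1 h.symm
        · exact Or.inr h
      · rcases hdisj _ (inv_mem (g * u * g⁻¹) hP.left_mem hP.right_mem hx) with h | h
        · exact Or.inr h
        · left
          rw [RelIso.apply_inv_self] at h
          exact OrderIso.inv_apply_eq_self_iff.1 h.symm
    -- In `Q` the commutator survives, since an element commuting with its conjugate by `ρ g`
    -- commutes with `ρ g`. On each remaining gap its support stays in the hull of `[l', r']` and
    -- its image under `g`.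
    refine ih (fun P' hP' => hL P' (Finset.mem_insert_of_mem hP')) ⁅u, g * u * g⁻¹⁆ ?_ ?_ ?_
    · rw [map_commutatorElement, map_mul, map_mul, map_inv]
      intro h1
      exact hgu (IsFreeGroup.commute_of_commute_conj (commutatorElement_eq_one_iff_commute.1 h1))
    · intro x hx hne
      have : ∃ P' ∈ insert P L, x ∈ Ioo P'.1 P'.2 := by
        rcases hmoved x hne with h | h
        · exact hsupp x hx h
        · have hx' : (ψ g)⁻¹ x ∈ Icc o o' := by
            rw [← map_inv]
            exact OrderIso.apply_mem_Icc (ho _) (ho' _) hx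
          obtain ⟨P', hP', hxP'⟩ := hsupp _ hx' h
          refine ⟨P', hP', ?_⟩
          have := OrderIso.apply_mem_Ioo ((hL P' hP').left_mem g) ((hL P' hP').right_mem g) hxP'
          rwa [RelIso.apply_inv_self] at this
      obtain ⟨P', hP', hxP'⟩ := this
      rcases Finset.mem_insert.1 hP' with rfl | hP'
      · exact absurd (htriv x hxP') hne
      · exact ⟨P', hP', hxP'⟩
    · intro P' hP'
      have hP'' := hL P' (Finset.mem_insert_of_mem hP')
      obtain ⟨l', r', h1, h2, h3, h4⟩ := hcpt P' (Finset.mem_insert_of_mem hP')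
      have hl' := OrderIso.apply_mem_Ioo (hP''.left_mem g) (hP''.right_mem g)
        (⟨h1, h2.trans_lt h3⟩ : l' ∈ Ioo P'.1 P'.2)
      have hr' := OrderIso.apply_mem_Ioo (hP''.left_mem g) (hP''.right_mem g)
        (⟨h1.trans_le h2, h3⟩ : r' ∈ Ioo P'.1 P'.2)
      refine ⟨min l' (ψ g l'), max r' (ψ g r'), lt_min h1 hl'.1,
        (min_le_left _ _).trans (h2.trans (le_max_left _ _)), max_lt h3 hr'.2, ?_⟩
      intro x hx hne
      rcases hmoved x hne with h | h
      · have := h4 x hx h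
        exact ⟨(min_le_left _ _).trans this.1, this.2.trans (le_max_left _ _)⟩
      · have := h4 _ (inv_mem g hP''.left_mem hP''.right_mem hx) h
        rw [mem_Icc, OrderIso.le_inv_apply_iff, OrderIso.inv_apply_le_iff] at this
        exact ⟨(min_le_right _ _).trans this.1, this.2.trans (le_max_right _ _)⟩

/-- An element whose support inside `[o, o']` lies in a compact set without global fixed points
gives rise to an element acting trivially on `[o, o']`. -/
theorem exists_trivial_of_compact {Γ Q : Type*} [Group Γ] [Group Q] [IsFreeGroup Q]
    {ψ : Γ →* (ℝ ≃o ℝ)} {o o' : ℝ} (ho : o ∈ globalFixed ψ) (ho' : o' ∈ globalFixed ψ)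
    {ρ : Γ →* Q} {s t : Γ} (hst : ∀ z, Commute z (ρ s) → Commute z (ρ t) → z = 1)
    {u : Γ} (hu : ρ u ≠ 1) {K : Set ℝ} (hK : IsCompact K) (hKF : ∀ x ∈ K, x ∉ globalFixed ψ)
    (hsupp : ∀ x ∈ Icc o o', ψ u x ≠ x → x ∈ K) :
    ∃ u', ρ u' ≠ 1 ∧ ∀ x ∈ Icc o o', ψ u' x = x := by
  classical
  have hgap : ∀ x ∈ K ∩ Icc o o', ∃ P : ℝ × ℝ, IsGap (globalFixed ψ) P.1 P.2 ∧ x ∈ Ioo P.1 P.2 := by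
    rintro x ⟨hxK, hx⟩
    obtain ⟨p, q, h, hx, -⟩ := IsGap.exists_of_notMem (isClosed_globalFixed ψ) (hKF x hxK) ho ho'
      hx.1 hx.2
    exact ⟨(p, q), h, hx⟩
  choose! P hP hxP using hgap
  obtain ⟨T, hT, hcover⟩ := (hK.inter_right isClosed_Icc : IsCompact (K ∩ Icc o o')).elim_nhds_subcover
    (fun x => Ioo (P x).1 (P x).2) (fun x hx => isOpen_Ioo.mem_nhds (hxP x hx))
  refine exists_trivial_of_finset ho ho' hst (T.image P) ?_ u hu ?_ ?_
  · intro P' hP'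
    obtain ⟨x, hx, rfl⟩ := Finset.mem_image.1 hP'
    exact hP x (hT x hx)
  · intro x hx hne
    obtain ⟨y, hy, hxy⟩ := mem_iUnion₂.1 (hcover ⟨hsupp x hx hne, hx⟩)
    exact ⟨P y, Finset.mem_image_of_mem P hy, hxy⟩
  · intro P' hP'
    obtain ⟨y, hy, rfl⟩ := Finset.mem_image.1 hP'
    have hg := hP y (hT y hy)
    obtain ⟨-, hy1, hy2⟩ := hT y hy
    have hy' := hxP y (hT y hy)
    -- The endpoints of the gap are globally fixed, so the compact set misses them and stays at a
    -- positive distance from both.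
    have hc : IsCompact (K ∩ Icc (P y).1 (P y).2) := hK.inter_right isClosed_Icc
    have hyc : y ∈ K ∩ Icc (P y).1 (P y).2 := ⟨(hT y hy).1, hy'.1.le, hy'.2.le⟩
    obtain ⟨l, hl, hl'⟩ := hc.exists_isLeast ⟨y, hyc⟩
    obtain ⟨r, hr, hr'⟩ := hc.exists_isGreatest ⟨y, hyc⟩
    refine ⟨l, r, ?_, hl' hr, ?_, ?_⟩
    · exact hl.2.1.lt_of_ne fun h => hKF l hl.1 (h ▸ hg.left_mem)
    · exact hr.2.2.lt_of_ne fun h => hKF r hr.1 (h ▸ hg.right_mem)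
    · intro x hx hne
      have hxK : x ∈ K := by
        refine hsupp x ?_ hne
        have h1 : o ≤ (P y).1 := hg.left_le ho hy' hy1
        have h2 : (P y).2 ≤ o' := hg.le_right ho' hy' hy2
        exact ⟨h1.trans hx.1.le, hx.2.le.trans h2⟩
      have : x ∈ K ∩ Icc (P y).1 (P y).2 := ⟨hxK, hx.1.le, hx.2.le⟩
      exact ⟨hl' this, hr' this⟩

/-! ### Hölder's theorem -/

lemma zpow_lt_zpow_of_order {G : Type*} [Group G] {e : G → ℝ}
    (hl : ∀ h f g, e f < e g → e (h * f) < e (h * g)) {h : G} (hh : e 1 < e h) {n m : ℤ}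
    (hnm : n < m) : e (h ^ n) < e (h ^ m) := by
  obtain ⟨k, rfl⟩ : ∃ k : ℕ, m = n + (k + 1) := ⟨(m - n - 1).toNat, by omega⟩
  have : ∀ k : ℕ, e 1 < e (h ^ (k + 1)) := by
    intro k
    induction k with
    | zero => simpa using hh
    | succ k ih =>
      rw [pow_succ]
      have := hl (h ^ (k + 1)) 1 h hh
      rw [mul_one] at this
      exact ih.trans this
  have := hl (h ^ n) _ _ (this k)
  rw [mul_one, ← zpow_natCast, ← zpow_add] at this
  exact_mod_cast this

/-- A group with a bi-invariant Archimedean total preorder, induced by a real function, is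
commutative up to the equivalence relation of the preorder. -/
lemma mul_comm_of_archimedean {G : Type*} [Group G] {e : G → ℝ}
    (hl : ∀ h f g, e f < e g → e (h * f) < e (h * g))
    (hr : ∀ h f g, e f < e g → e (f * h) < e (g * h))
    (arch : ∀ h f, e 1 < e h → ∃ n : ℤ, e f < e (h ^ n)) (f g : G) : e (f * g) = e (g * f) := by
  have hl' : ∀ h f g, e f ≤ e g → e (h * f) ≤ e (h * g) := by
    intro h f g hfg
    by_contra! hlt
    have := hl h⁻¹ _ _ hlt
    simp only [inv_mul_cancel_left] at this
    exact hfg.not_gt this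
  have hr' : ∀ h f g, e f ≤ e g → e (f * h) ≤ e (g * h) := by
    intro h f g hfg
    by_contra! hlt
    have := hr h⁻¹ _ _ hlt
    simp only [mul_inv_cancel_right] at this
    exact hfg.not_gt this
  have hfloor : ∀ h f, e 1 < e h → ∃ m : ℤ, e (h ^ m) ≤ e f ∧ e f < e (h ^ (m + 1)) := by
    intro h f hh
    obtain ⟨n, hn⟩ := arch h f hh
    obtain ⟨n', hn'⟩ := arch h f⁻¹ hh
    have hlow : e (h ^ (-n')) ≤ e f := by
      have := hr f _ _ (hl (h ^ (-n')) _ _ hn')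
      rw [← zpow_add, neg_add_cancel, zpow_zero, one_mul, inv_mul_cancel_right] at this
      exact this.le
    obtain ⟨m, hm, hmax⟩ := Int.exists_greatest_of_bdd (P := fun m => e (h ^ m) ≤ e f)
      ⟨n, fun m hm => by
        by_contra! hlt
        exact (hm.trans_lt hn).not_gt (zpow_lt_zpow_of_order hl hh hlt)⟩ ⟨-n', hlow⟩
    refine ⟨m, hm, ?_⟩
    by_contra! hle
    have := hmax _ hle
    omega
  have key : ∀ f g, ¬ e (g * f) < e (f * g) := by
    intro f g hlt
    set k := f * g * (g * f)⁻¹ with hk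
    have hk1 : e 1 < e k := by
      have := hr (g * f)⁻¹ _ _ hlt
      rwa [mul_inv_cancel] at this
    -- Locating `f` and `g` between consecutive powers of `h` puts the commutator `k` below `h ^ 2`.
    have hA : ∀ h, e 1 < e h → e k < e (h * h) := by
      intro h hh
      obtain ⟨m, hm, hm'⟩ := hfloor h f hh
      obtain ⟨n, hn, hn'⟩ := hfloor h g hh
      have h1 : e (f * g) < e (h ^ (m + 1) * h ^ (n + 1)) :=
        (hr g _ _ hm').trans (hl (h ^ (m + 1)) _ _ hn')
      have h2 : e (h ^ n * h ^ m) ≤ e (g * f) := (hr' _ _ _ hn).trans (hl' _ _ _ hm)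
      have h3 : h ^ (m + 1) * h ^ (n + 1) = h * h * (h ^ n * h ^ m) := by
        simp only [← zpow_one_add, ← zpow_add, mul_assoc]
        congr 1
        ring
      rw [h3] at h1
      have h4 := hr (g * f)⁻¹ _ _ (h1.trans_le (hl' (h * h) _ _ h2))
      rwa [mul_inv_cancel_right, ← hk] at h4
    -- If `1 < h < k`, the smaller of `h` and `h⁻¹ k` has square at most `k`, against the previous
    -- bound. So `k` is a least positive element, every element is equivalent to a power of `k`, and
    -- powers of `k` commute.
    have hB : ∀ h, e 1 < e h → e k ≤ e h := by
      intro h hh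
      by_contra! hlt
      have h' : e 1 < e (h⁻¹ * k) := by
        have := hl h⁻¹ _ _ hlt
        rwa [inv_mul_cancel] at this
      have hhk : h * (h⁻¹ * k) = k := mul_inv_cancel_left h k
      rcases le_or_gt (e h) (e (h⁻¹ * k)) with hle | hgt
      · have := hl' h _ _ hle
        rw [hhk] at this
        exact this.not_gt (hA h hh)
      · have := hr (h⁻¹ * k) _ _ hgt
        rw [hhk] at this
        exact lt_asymm this (hA _ h')
    have hC : ∀ f, ∃ m : ℤ, e f = e (k ^ m) := by
      intro f
      obtain ⟨m, hm, hm'⟩ := hfloor k f hk1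
      refine ⟨m, le_antisymm ?_ hm⟩
      by_contra! hlt
      have h1 := hl (k ^ (-m)) _ _ hlt
      have h2 := hl (k ^ (-m)) _ _ hm'
      rw [← zpow_add, neg_add_cancel, zpow_zero] at h1
      rw [← zpow_add, neg_add_cancel_left, zpow_one] at h2
      exact (hB _ h1).not_gt h2
    obtain ⟨m, hm⟩ := hC f
    obtain ⟨n, hn⟩ := hC g
    have h1 : e (f * g) = e (k ^ m * k ^ n) := le_antisymm
      ((hr' _ _ _ hm.le).trans (hl' _ _ _ hn.le)) ((hl' _ _ _ hn.ge).trans (hr' _ _ _ hm.ge))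
    have h2 : e (g * f) = e (k ^ n * k ^ m) := le_antisymm
      ((hr' _ _ _ hn.le).trans (hl' _ _ _ hm.le)) ((hl' _ _ _ hm.ge).trans (hr' _ _ _ hn.ge))
    rw [h1, h2, ← zpow_add, ← zpow_add, add_comm] at hlt
    exact lt_irrefl _ hlt
  exact le_antisymm (not_lt.1 (key f g)) (not_lt.1 (key g f))

lemma OrderIso.forall_lt_of_lt_of_ne {f : ℝ ≃o ℝ} {p q : ℝ} (hne : ∀ x ∈ Ioo p q, f x ≠ x)
    {x₀ : ℝ} (hx₀ : x₀ ∈ Ioo p q) (h : x₀ < f x₀) : ∀ x ∈ Ioo p q, x < f x := by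
  intro x hx
  by_contra! hle
  obtain ⟨y, hy, hy'⟩ := isPreconnected_Ioo.intermediate_value₂ hx₀ hx continuousOn_id
    f.continuous.continuousOn h.le hle
  exact hne y hy hy'.symm

lemma globalFixed_zpowersHom (f : ℝ ≃o ℝ) :
    globalFixed (zpowersHom (ℝ ≃o ℝ) f) = Function.fixedPoints f := by
  ext x
  constructor
  · intro h
    have := h (Multiplicative.ofAdd 1)
    rwa [zpowersHom_apply, toAdd_ofAdd, zpow_one] at this
  · intro h n
    have hx : f ∈ MulAction.stabilizer (ℝ ≃o ℝ) x := h
    have := (MulAction.stabilizer (ℝ ≃o ℝ) x).zpow_mem hx n.toAdd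
    simpa [zpowersHom_apply] using MulAction.mem_stabilizer_iff.1 this

lemma IsGap.exists_lt_zpow_apply {f : ℝ ≃o ℝ} {p q l r : ℝ}
    (h : IsGap (Function.fixedPoints f) p q) (hl : p < l) (hr : r < q) :
    ∃ n : ℤ, r < (f ^ n) l := by
  rw [← globalFixed_zpowersHom] at h
  obtain ⟨n, hn⟩ := h.exists_lt_apply hl hr
  exact ⟨n.toAdd, by simpa [zpowersHom_apply] using hn⟩

/-- **Hölder's theorem**: a group of homeomorphisms of an interval, each of which either has no
fixed point or is the identity, is commutative. -/
theorem mul_comm_of_free {S : Subgroup (ℝ ≃o ℝ)} {p q : ℝ} (hp : ∀ f ∈ S, f p = p)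
    (hq : ∀ f ∈ S, f q = q)
    (hfree : ∀ f ∈ S, ∀ x₀ ∈ Ioo p q, f x₀ = x₀ → ∀ x ∈ Ioo p q, f x = x)
    {f g : ℝ ≃o ℝ} (hf : f ∈ S) (hg : g ∈ S) {x : ℝ} (hx : x ∈ Ioo p q) : f (g x) = g (f x) := by
  -- Elements are ordered by their values at `x`. Freeness gives right invariance: an element moving
  -- `x` to the right moves every point of `(p, q)` to the right.
  have := mul_comm_of_archimedean (G := S) (e := fun f => (f : ℝ ≃o ℝ) x) ?_ ?_ ?_ ⟨f, hf⟩ ⟨g, hg⟩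
  · exact this
  · intro h f g hfg
    exact (h : ℝ ≃o ℝ).lt_iff_lt.2 hfg
  · intro h f g hfg
    have hk : ((f⁻¹ * g : S) : ℝ ≃o ℝ) ∈ S := SetLike.coe_mem _
    have h1 : x < ((f⁻¹ * g : S) : ℝ ≃o ℝ) x := OrderIso.lt_inv_apply_iff.2 hfg
    have h2 := OrderIso.forall_lt_of_lt_of_ne
      (fun y hy hy' => h1.ne' (hfree _ hk y hy hy' x hx)) hx h1 _
      (OrderIso.apply_mem_Ioo (hp h h.2) (hq h h.2) hx)
    exact (OrderIso.lt_inv_apply_iff (f := (f : ℝ ≃o ℝ))).1 h2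
  · intro h f hh
    have hgap : IsGap (Function.fixedPoints (h : ℝ ≃o ℝ)) p q :=
      ⟨hx.1.trans hx.2, hp h h.2, hq h h.2, fun y hy hy' => hh.ne' (hfree h h.2 y hy hy' x hx)⟩
    obtain ⟨n, hn⟩ := hgap.exists_lt_zpow_apply hx.1
      (OrderIso.apply_mem_Ioo (hp f f.2) (hq f f.2) hx).2
    exact ⟨n, by simpa using hn⟩

/-! ### The Kopell property -/

/-- The conclusion of Kopell's lemma: if `g` has no fixed points in `(p, q)` and `f` commutes with
`g` there and has a fixed point, then `f` is the identity. -/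
def KopellProperty (G : Subgroup (ℝ ≃o ℝ)) : Prop :=
  ∀ f ∈ G, ∀ g ∈ G, ∀ p q, IsGap (Function.fixedPoints g) p q →
    (∀ x ∈ Ioo p q, f (g x) = g (f x)) → ∀ x₀ ∈ Ioo p q, f x₀ = x₀ → ∀ x ∈ Ioo p q, f x = x

/-- The fixed points of `f` are unbounded in both directions. -/
def UnboundedFixed (f : ℝ ≃o ℝ) : Prop :=
  (∀ x, ∃ y ≤ x, f y = y) ∧ ∀ x, ∃ y, x ≤ y ∧ f y = y

lemma UnboundedFixed.exists_isGap {f : ℝ ≃o ℝ} (hf : UnboundedFixed f) {x : ℝ} (hx : f x ≠ x) :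
    ∃ p q, IsGap (Function.fixedPoints f) p q ∧ x ∈ Ioo p q := by
  obtain ⟨y, hy, hy'⟩ := hf.1 x
  obtain ⟨z, hz, hz'⟩ := hf.2 x
  obtain ⟨p, q, h, hx, -⟩ := IsGap.exists_of_notMem (isClosed_fixedPoints f.continuous) hx hy' hz'
    hy hz
  exact ⟨p, q, h, hx⟩

lemma Commute.orderIso_apply {f g : ℝ ≃o ℝ} (h : Commute f g) (x : ℝ) : f (g x) = g (f x) :=
  DFunLike.congr_fun h.eq x

/-- An endpoint of one component lying inside the other would be a fixed point there, and the Kopell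
property would make the map trivial on that other component, including at `x`. -/
lemma KopellProperty.eq_of_mem {G : Subgroup (ℝ ≃o ℝ)} (hG : KopellProperty G) {f g : ℝ ≃o ℝ}
    (hf : f ∈ G) (hg : g ∈ G) (hfg : Commute f g) {p q p' q' x : ℝ}
    (h : IsGap (Function.fixedPoints f) p q) (h' : IsGap (Function.fixedPoints g) p' q')
    (hx : x ∈ Ioo p q) (hx' : x ∈ Ioo p' q') : p = p' ∧ q = q' := by
  have key : ∀ {f g : ℝ ≃o ℝ}, f ∈ G → g ∈ G → Commute f g → ∀ {p q p' q'},
      IsGap (Function.fixedPoints f) p q → IsGap (Function.fixedPoints g) p' q' →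
      x ∈ Ioo p q → x ∈ Ioo p' q' → p ≤ p' ∧ q' ≤ q := by
    intro f g hf hg hfg p q p' q' h h' hx hx'
    constructor
    · by_contra! hlt
      exact h.notMem x hx (hG f hf g hg p' q' h' (fun y _ => hfg.orderIso_apply y) p
        ⟨hlt, hx.1.trans hx'.2⟩ h.left_mem x hx')
    · by_contra! hlt
      exact h.notMem x hx (hG f hf g hg p' q' h' (fun y _ => hfg.orderIso_apply y) q
        ⟨hx'.1.trans hx.2, hlt⟩ h.right_mem x hx')
  have h1 := key hf hg hfg h h' hx hx'
  have h2 := key hg hf hfg.symm h' h hx' hx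
  exact ⟨le_antisymm h1.1 h2.1, le_antisymm h2.2 h1.2⟩

/-- If `f` and `g` commute, then on each component of the support of `f` either `g` is trivial or
the component is also one of the support of `g`. -/
lemma KopellProperty.trivial_or_isGap {G : Subgroup (ℝ ≃o ℝ)} (hG : KopellProperty G)
    {f g : ℝ ≃o ℝ} (hf : f ∈ G) (hg : g ∈ G) (hfg : Commute f g) (hgu : UnboundedFixed g)
    {p q : ℝ} (h : IsGap (Function.fixedPoints f) p q) :
    (∀ x ∈ Ioo p q, g x = x) ∨ IsGap (Function.fixedPoints g) p q := by
  by_cases hall : ∀ x ∈ Ioo p q, g x = x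
  · exact Or.inl hall
  · push Not at hall
    obtain ⟨x, hx, hne⟩ := hall
    obtain ⟨p', q', h', hx'⟩ := hgu.exists_isGap hne
    obtain ⟨rfl, rfl⟩ := hG.eq_of_mem hf hg hfg h h' hx hx'
    exact Or.inr h'

lemma KopellProperty.apply_endpoints {G : Subgroup (ℝ ≃o ℝ)} (hG : KopellProperty G)
    {f g : ℝ ≃o ℝ} (hf : f ∈ G) (hg : g ∈ G) (hfg : Commute f g) (hgu : UnboundedFixed g)
    {p q : ℝ} (h : IsGap (Function.fixedPoints f) p q) : g p = p ∧ g q = q := by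
  rcases hG.trivial_or_isGap hf hg hfg hgu h with h' | h'
  · have hcl : Icc p q ⊆ Function.fixedPoints g := by
      rw [← closure_Ioo h.lt.ne]
      exact closure_minimal h' (isClosed_fixedPoints g.continuous)
    exact ⟨hcl (left_mem_Icc.2 h.lt.le), hcl (right_mem_Icc.2 h.lt.le)⟩
  · exact ⟨h'.left_mem, h'.right_mem⟩

/-- Elements of the centralizer of `g` commute with each other on the components of the support
of `g`. -/
lemma KopellProperty.comm_of_commute {G : Subgroup (ℝ ≃o ℝ)} (hG : KopellProperty G)
    {f₁ f₂ g : ℝ ≃o ℝ} (hf₁ : f₁ ∈ G) (hf₂ : f₂ ∈ G) (hg : g ∈ G) (h₁ : Commute f₁ g)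
    (h₂ : Commute f₂ g) (hu₁ : UnboundedFixed f₁) (hu₂ : UnboundedFixed f₂)
    {p q x : ℝ} (h : IsGap (Function.fixedPoints g) p q) (hx : x ∈ Ioo p q) :
    f₁ (f₂ x) = f₂ (f₁ x) := by
  have e₁ := hG.apply_endpoints hg hf₁ h₁.symm hu₁ h
  have e₂ := hG.apply_endpoints hg hf₂ h₂.symm hu₂ h
  -- By the Kopell property, an element of the centralizer of `g` with a fixed point in the
  -- component is trivial on it; this is the freeness that Hölder's theorem needs.
  let S : Subgroup (ℝ ≃o ℝ) := (G ⊓ Subgroup.centralizer {g}) ⊓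
    (MulAction.stabilizer (ℝ ≃o ℝ) p ⊓ MulAction.stabilizer (ℝ ≃o ℝ) q)
  have hS : ∀ f, f ∈ S ↔ (f ∈ G ∧ Commute f g) ∧ f p = p ∧ f q = q := fun f => by
    simp only [S, Subgroup.mem_inf, Subgroup.mem_centralizer_singleton_iff]
    exact Iff.rfl
  refine mul_comm_of_free (S := S) (p := p) (q := q) (fun f hf => ((hS f).1 hf).2.1)
    (fun f hf => ((hS f).1 hf).2.2) ?_ ((hS _).2 ⟨⟨hf₁, h₁⟩, e₁⟩) ((hS _).2 ⟨⟨hf₂, h₂⟩, e₂⟩) hx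
  intro f hf x₀ hx₀ hfx
  have := (hS f).1 hf
  exact hG f this.1.1 g hg p q h (fun y _ => this.1.2.orderIso_apply y) x₀ hx₀ hfx

/-! ### Kopell's lemma -/

/-- A positive derivative of bounded variation has bounded distortion over the iterates of a
fundamental domain. -/
lemma distortion_bound {g : ℝ ≃o ℝ} {p q t : ℝ} (hp : g p = p)
    (hlt : ∀ x ∈ Ioo p q, g x < x) (ht : t ∈ Ioo p q) (hg : ContDiffOn ℝ 1 g (Icc p q))
    (hpos : ∀ x ∈ Icc p q, 0 < derivWithin g (Icc p q) x)
    (hbv : BoundedVariationOn (derivWithin g (Icc p q)) (Icc p q)) :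
    ∃ C > 0, ∀ n : ℕ, ∀ x y x' y', g t ≤ x → x < y → y ≤ t → g t ≤ x' → x' < y' → y' ≤ t →
      (g^[n] y - g^[n] x) * (y' - x') ≤ C * ((g^[n] y' - g^[n] x') * (y - x)) := by
  have hpq : p < q := ht.1.trans ht.2
  set D := derivWithin g (Icc p q) with hD
  have hDc : ContinuousOn D (Icc p q) := hg.continuousOn_derivWithin (uniqueDiffOn_Icc hpq) le_rfl
  obtain ⟨z, hz, hzmin⟩ := isCompact_Icc.exists_isMinOn (nonempty_Icc.2 hpq.le) hDc
  set m := D z with hm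
  have hm0 : 0 < m := hpos z hz
  have hmle : ∀ x ∈ Icc p q, m ≤ D x := fun x hx => hzmin hx
  have hτ : ∀ n, g^[n] t ∈ Ioo p q := by
    intro n
    induction n with
    | zero => exact ht
    | succ n ih =>
      rw [Function.iterate_succ_apply']
      refine ⟨?_, (hlt _ ih).trans ih.2⟩
      have := g.lt_iff_lt.2 ih.1
      rwa [hp] at this
  have hmono : ∀ n, StrictMono (g^[n]) := fun n => g.strictMono.iterate n
  have hsub : ∀ n, Icc (g^[n + 1] t) (g^[n] t) ⊆ Icc p q := fun n =>
    Icc_subset_Icc (hτ _).1.le (hτ _).2.le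
  have hmvt : ∀ X Y, X ∈ Icc p q → Y ∈ Icc p q → X < Y →
      ∃ ξ ∈ Ioo X Y, g Y - g X = D ξ * (Y - X) := by
    intro X Y hX hY hXY
    obtain ⟨ξ, hξ, h⟩ := exists_hasDerivAt_eq_slope g D hXY g.continuous.continuousOn (by
      intro x hx
      have hx' : x ∈ Ioo p q := ⟨hX.1.trans_lt hx.1, hx.2.trans_le hY.2⟩
      exact ((hg.differentiableOn one_ne_zero _ (Ioo_subset_Icc_self hx')).hasDerivWithinAt).hasDerivAt
        (Icc_mem_nhds hx'.1 hx'.2))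
    exact ⟨ξ, hξ, by rw [h, div_mul_cancel₀ _ (sub_pos.2 hXY).ne']⟩
  set v : ℕ → ℝ := fun n => (eVariationOn D (Icc (g^[n] t) t)).toReal with hv
  have hbv' : ∀ a b, p ≤ a → b ≤ q → BoundedVariationOn D (Icc a b) := fun a b ha hb =>
    hbv.mono (Icc_subset_Icc ha hb)
  have hle : ∀ n, g^[n + 1] t ≤ g^[n] t := fun n => by
    rw [Function.iterate_succ_apply']
    exact (hlt _ (hτ n)).le
  have hlet : ∀ n, g^[n] t ≤ t := by
    intro n
    induction n with
    | zero => exact le_rfl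
    | succ n ih => exact (hle n).trans ih
  have hvsucc : ∀ n, v (n + 1) = (eVariationOn D (Icc (g^[n + 1] t) (g^[n] t))).toReal + v n := by
    intro n
    have := eVariationOn.Icc_add_Icc D (s := univ) (hle n) (hlet n) (mem_univ _)
    simp only [univ_inter] at this
    simp only [hv]
    rw [← this, ENNReal.toReal_add (hbv' _ _ (hτ _).1.le (hτ _).2.le) (hbv' _ _ (hτ _).1.le ht.2.le)]
  have hvle : ∀ n, v n ≤ (eVariationOn D (Icc p q)).toReal := fun n =>
    ENNReal.toReal_mono hbv (eVariationOn.mono _ (Icc_subset_Icc (hτ _).1.le ht.2.le))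
  -- As `D ≥ m`, the ratio `D ξ / D η` is at most `1 + w / m ≤ exp (w / m)`. Multiplied over
  -- successive fundamental domains, the exponents add up to at most the total variation divided by
  -- `m`.
  have hratio : ∀ n, ∀ ξ ∈ Icc (g^[n + 1] t) (g^[n] t), ∀ η ∈ Icc (g^[n + 1] t) (g^[n] t),
      D ξ ≤ D η * Real.exp ((eVariationOn D (Icc (g^[n + 1] t) (g^[n] t))).toReal / m) := by
    intro n ξ hξ η hη
    set w := (eVariationOn D (Icc (g^[n + 1] t) (g^[n] t))).toReal
    have h1 : dist (D ξ) (D η) ≤ w :=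
      (hbv' _ _ (hτ _).1.le (hτ _).2.le).dist_le hξ hη
    rw [Real.dist_eq] at h1
    have h2 := hmle η (hsub n hη)
    have hw : 0 ≤ w := ENNReal.toReal_nonneg
    have h3 : w / m + 1 ≤ Real.exp (w / m) := Real.add_one_le_exp _
    calc D ξ ≤ D η + w := by linarith [le_abs_self (D ξ - D η)]
      _ ≤ D η * (w / m + 1) := by
        have : w = m * (w / m) := by field_simp
        have h4 : 0 ≤ w / m := by positivity
        nlinarith
      _ ≤ _ := mul_le_mul_of_nonneg_left h3 (hm0.le.trans h2)
  refine ⟨Real.exp ((eVariationOn D (Icc p q)).toReal / m), Real.exp_pos _, ?_⟩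
  intro n x y x' y' hx hxy hy hx' hxy' hy'
  have key : (g^[n] y - g^[n] x) * (y' - x') ≤
      Real.exp (v n / m) * ((g^[n] y' - g^[n] x') * (y - x)) := by
    induction n with
    | zero =>
      have : 1 ≤ Real.exp (v 0 / m) := Real.one_le_exp (div_nonneg ENNReal.toReal_nonneg hm0.le)
      have h0 : 0 ≤ (y' - x') * (y - x) := mul_nonneg (sub_pos.2 hxy').le (sub_pos.2 hxy).le
      simp only [Function.iterate_zero, id_eq]
      nlinarith
    | succ n ih =>
      have hmem : ∀ z, g t ≤ z → z ≤ t → g^[n] z ∈ Icc (g^[n + 1] t) (g^[n] t) := by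
        intro z h1 h2
        rw [Function.iterate_succ_apply]
        exact ⟨(hmono n).monotone h1, (hmono n).monotone h2⟩
      have hX := hmem x hx (hxy.le.trans hy)
      have hY := hmem y (hx.trans hxy.le) hy
      have hX' := hmem x' hx' (hxy'.le.trans hy')
      have hY' := hmem y' (hx'.trans hxy'.le) hy'
      obtain ⟨ξ, hξ, e⟩ := hmvt _ _ (hsub n hX) (hsub n hY) (hmono n hxy)
      obtain ⟨η, hη, e'⟩ := hmvt _ _ (hsub n hX') (hsub n hY') (hmono n hxy')
      have hξ' : ξ ∈ Icc (g^[n + 1] t) (g^[n] t) := ⟨hX.1.trans hξ.1.le, hξ.2.le.trans hY.2⟩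
      have hη' : η ∈ Icc (g^[n + 1] t) (g^[n] t) := ⟨hX'.1.trans hη.1.le, hη.2.le.trans hY'.2⟩
      have hr := hratio n ξ hξ' η hη'
      have hDη : 0 < D η := hpos _ (hsub n hη')
      have h1 : 0 ≤ (g^[n] y - g^[n] x) * (y' - x') :=
        mul_nonneg (sub_pos.2 (hmono n hxy)).le (sub_pos.2 hxy').le
      simp only [Function.iterate_succ_apply']
      rw [e, e', hvsucc, add_div, Real.exp_add]
      set E := Real.exp ((eVariationOn D (Icc (g^[n + 1] t) (g^[n] t))).toReal / m)
      calc D ξ * (g^[n] y - g^[n] x) * (y' - x') = D ξ * ((g^[n] y - g^[n] x) * (y' - x')) := by ring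
        _ ≤ (D η * E) * (Real.exp (v n / m) * ((g^[n] y' - g^[n] x') * (y - x))) :=
          mul_le_mul hr ih h1 (mul_nonneg hDη.le (Real.exp_pos _).le)
        _ = _ := by ring
  refine key.trans (mul_le_mul_of_nonneg_right (Real.exp_le_exp.2 ?_) ?_)
  · exact div_le_div_of_nonneg_right (hvle n) hm0.le
  · exact mul_nonneg (sub_pos.2 (hmono n hxy')).le (sub_pos.2 hxy).le

/-- A `C¹` map commuting with a contraction and fixing a point is Lipschitz on a fundamental
domain, with a constant depending only on the distortion of the contraction. -/
lemma sub_le_of_distortion {g h : ℝ ≃o ℝ} {p q t C : ℝ} (hp : g p = p)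
    (hlt : ∀ x ∈ Ioo p q, g x < x) (ht : t ∈ Ioo p q) (hC : 0 < C)
    (hdist : ∀ n : ℕ, ∀ x y x' y', g t ≤ x → x < y → y ≤ t → g t ≤ x' → x' < y' → y' ≤ t →
      (g^[n] y - g^[n] x) * (y' - x') ≤ C * ((g^[n] y' - g^[n] x') * (y - x)))
    (hh : ContDiffOn ℝ 1 h (Icc p q)) (hhp : h p = p)
    (hcomm : ∀ x ∈ Ioo p q, h (g x) = g (h x)) (hht : h t = t) {x y : ℝ}
    (hx : g t ≤ x) (hxy : x < y) (hy : y ≤ t) : h y - h x ≤ 2 * C * (y - x) := by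
  have hpq : p < q := ht.1.trans ht.2
  have hmem : ∀ z ∈ Ioo p q, ∀ n, g^[n] z ∈ Ioo p q := by
    intro z hz n
    induction n with
    | zero => exact hz
    | succ n ih =>
      rw [Function.iterate_succ_apply']
      refine ⟨?_, (hlt _ ih).trans ih.2⟩
      have := g.lt_iff_lt.2 ih.1
      rwa [hp] at this
  have hcomm' : ∀ z ∈ Ioo p q, ∀ n, h (g^[n] z) = g^[n] (h z) := by
    intro z hz n
    induction n with
    | zero => rfl
    | succ n ih => rw [Function.iterate_succ_apply', Function.iterate_succ_apply',
        hcomm _ (hmem z hz n), ih]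
  have hlim : Filter.Tendsto (fun n => g^[n] t) Filter.atTop (nhds p) := by
    have hanti : Antitone fun n => g^[n] t := antitone_nat_of_succ_le fun n => by
      rw [Function.iterate_succ_apply']
      exact (hlt _ (hmem t ht n)).le
    have hb : BddBelow (range fun n => g^[n] t) := ⟨p, by
      rintro _ ⟨n, rfl⟩
      exact (hmem t ht n).1.le⟩
    have h1 := tendsto_atTop_ciInf hanti hb
    set i := ⨅ n, g^[n] t with hi
    have hfix : g i = i := by
      refine tendsto_nhds_unique ((g.continuous.tendsto i).comp h1) ?_
      refine (h1.comp (Filter.tendsto_add_atTop_nat 1)).congr fun n => ?_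
      simp only [Function.comp_apply]
      exact Function.iterate_succ_apply' g n t
    have hpi : p ≤ i := le_ciInf fun n => (hmem t ht n).1.le
    have hit : i ≤ t := ciInf_le hb 0
    rcases hpi.eq_or_lt with h2 | h2
    · rwa [← h2] at h1
    · exact absurd hfix (hlt i ⟨h2, hit.trans_lt ht.2⟩).ne
  have hdw : HasDerivWithinAt h (derivWithin h (Icc p q) p) (Icc p q) p :=
    (hh.differentiableOn one_ne_zero _ (left_mem_Icc.2 hpq.le)).hasDerivWithinAt
  -- The points `g^[n] t` are fixed by `h` and tend to `p`, so the difference quotients along them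
  -- are all one.
  have hone : derivWithin h (Icc p q) p = 1 := by
    rw [hasDerivWithinAt_iff_tendsto_slope] at hdw
    have h1 : Filter.Tendsto (fun n => g^[n] t) Filter.atTop
        (nhdsWithin p (Icc p q \ {p})) := by
      refine tendsto_nhdsWithin_iff.2 ⟨hlim, Filter.Eventually.of_forall fun n => ?_⟩
      exact ⟨Ioo_subset_Icc_self (hmem t ht n), (hmem t ht n).1.ne'⟩
    refine tendsto_nhds_unique (hdw.comp h1) (tendsto_const_nhds.congr fun n => ?_)
    have h2 : h (g^[n] t) = g^[n] t := by rw [hcomm' t ht n, hht]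
    have h3 : g^[n] t - p ≠ 0 := (sub_pos.2 (hmem t ht n).1).ne'
    simp only [Function.comp_apply, slope_def_field, h2, hhp]
    exact (div_self h3).symm
  have hcont : ContinuousWithinAt (derivWithin h (Icc p q)) (Icc p q) p :=
    hh.continuousOn_derivWithin (uniqueDiffOn_Icc hpq) le_rfl p (left_mem_Icc.2 hpq.le)
  have hev : ∀ᶠ z in nhdsWithin p (Icc p q), |derivWithin h (Icc p q) z| < 2 := by
    refine hcont.abs.eventually_lt_const ?_
    simp [hone]
  obtain ⟨δ, hδ, hδ'⟩ := Metric.mem_nhdsWithin_iff.1 hev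
  obtain ⟨n, hn⟩ := ((tendsto_order.1 hlim).2 (p + δ) (by linarith)).exists
  have hxI : x ∈ Ioo p q := by
    refine ⟨lt_of_lt_of_le ?_ hx, hxy.trans_le hy |>.trans ht.2⟩
    have := g.lt_iff_lt.2 ht.1
    rwa [hp] at this
  have hyI : y ∈ Ioo p q := ⟨hxI.1.trans hxy, hy.trans_lt ht.2⟩
  have hmono : StrictMono (g^[n]) := g.strictMono.iterate n
  have hhx : g t ≤ h x := by
    rw [← hht, ← hcomm t ht]
    exact h.monotone hx
  have hhy : h y ≤ t := by
    rw [← hht]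
    exact h.monotone hy
  -- Since `h` commutes with `g^[n]`, bounded distortion compares the stretching of `[x, y]` under
  -- `h` with that of `[g^[n] x, g^[n] y]`, which lies so close to `p` that `h` is 2-Lipschitz
  -- there.
  have h1 := hdist n x y (h x) (h y) hx hxy hy hhx (h.strictMono hxy) hhy
  rw [← hcomm' x hxI, ← hcomm' y hyI] at h1
  have h2 : h (g^[n] y) - h (g^[n] x) ≤ 2 * (g^[n] y - g^[n] x) := by
    have hsub : Icc p (g^[n] t) ⊆ Icc p q := Icc_subset_Icc_right (hmem t ht n).2.le
    have := (convex_Icc p (g^[n] t)).norm_image_sub_le_of_norm_hasDerivWithin_le (f := h)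
      (f' := derivWithin h (Icc p q)) (C := 2) (x := g^[n] x) (y := g^[n] y)
      (fun z hz => ((hh.differentiableOn one_ne_zero _ (hsub hz)).hasDerivWithinAt).mono hsub)
      (fun z hz => by
        have : z ∈ Metric.ball p δ ∩ Icc p q := by
          refine ⟨?_, hsub hz⟩
          rw [Metric.mem_ball, Real.dist_eq, abs_of_nonneg (sub_nonneg.2 hz.1)]
          linarith [hz.2]
        exact le_of_lt (hδ' this))
      ⟨(hmem x hxI n).1.le, hmono.monotone (hxy.le.trans hy)⟩
      ⟨(hmem y hyI n).1.le, hmono.monotone hy⟩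
    rw [Real.norm_eq_abs, Real.norm_eq_abs, abs_of_pos (sub_pos.2 (hmono hxy))] at this
    exact (le_abs_self _).trans this
  have h3 : 0 < g^[n] y - g^[n] x := sub_pos.2 (hmono hxy)
  have h4 : 0 < y - x := sub_pos.2 hxy
  have h5 : (g^[n] y - g^[n] x) * (h y - h x) ≤ (g^[n] y - g^[n] x) * (2 * C * (y - x)) := by
    refine h1.trans ?_
    have : C * ((h (g^[n] y) - h (g^[n] x)) * (y - x)) ≤
        C * ((2 * (g^[n] y - g^[n] x)) * (y - x)) := by gcongr
    linarith
  exact le_of_mul_le_mul_left h5 h3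

/-- All powers of `f` commute with `g` and fix the same points, so they share one Lipschitz constant
on a fundamental domain. If `f` moved a point `y` of a gap `(s, t)` of its fixed points, powers of
`f` would stretch arbitrarily short intervals ending at `t` to `[y, t]`. -/
lemma kopell_of_lt {f g : ℝ ≃o ℝ} {p q x₀ : ℝ} (hgap : IsGap (Function.fixedPoints g) p q)
    (hlt : ∀ x ∈ Ioo p q, g x < x) (hcomm : ∀ x ∈ Ioo p q, f (g x) = g (f x))
    (hx₀ : x₀ ∈ Ioo p q) (hfx₀ : f x₀ = x₀)
    (hg : ContDiffOn ℝ 1 g (Icc p q)) (hpos : ∀ x ∈ Icc p q, 0 < derivWithin g (Icc p q) x)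
    (hbv : BoundedVariationOn (derivWithin g (Icc p q)) (Icc p q))
    (hf : ∀ n : ℤ, ContDiffOn ℝ 1 (f ^ n : ℝ ≃o ℝ) (Icc p q)) : ∀ x ∈ Ioo p q, f x = x := by
  have hp : g p = p := hgap.left_mem
  have hq : g q = q := hgap.right_mem
  have hpinv : g⁻¹ p = p := OrderIso.inv_apply_eq_self_iff.2 hp
  have hqinv : g⁻¹ q = q := OrderIso.inv_apply_eq_self_iff.2 hq
  have horb : ∀ n : ℤ, (g ^ n) x₀ ∈ Ioo p q ∧ f ((g ^ n) x₀) = (g ^ n) x₀ := by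
    intro n
    induction n using Int.induction_on with
    | zero => exact ⟨hx₀, hfx₀⟩
    | succ n ih =>
      rw [add_comm, zpow_one_add, RelIso.mul_apply]
      exact ⟨OrderIso.apply_mem_Ioo hp hq ih.1, by rw [hcomm _ ih.1, ih.2]⟩
    | pred n ih =>
      have : g ^ (-(n : ℤ) - 1) = g⁻¹ * g ^ (-(n : ℤ)) := by
        rw [← zpow_neg_one, ← zpow_add]
        congr 1
        ring
      rw [this, RelIso.mul_apply]
      have hm := OrderIso.apply_mem_Ioo hpinv hqinv ih.1
      refine ⟨hm, ?_⟩
      have := hcomm _ hm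
      rw [RelIso.apply_inv_self, ih.2] at this
      nth_rw 2 [this]
      exact (RelIso.inv_apply_self g _).symm
  -- The `g`-orbit of `x₀` consists of fixed points of `f` accumulating at both ends; hence `f`
  -- fixes `p` and `q`, which is not assumed.
  have hnear_q : ∀ r < q, ∃ w ∈ Ioo p q, f w = w ∧ r < w := by
    intro r hr
    obtain ⟨n, hn⟩ := hgap.exists_lt_zpow_apply hx₀.1 hr
    exact ⟨_, (horb n).1, (horb n).2, hn⟩
  have hnear_p : ∀ l ∈ Ioo p q, ∃ w ∈ Ioo p q, f w = w ∧ w < l := by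
    intro l hl
    obtain ⟨n, hn⟩ := hgap.exists_lt_zpow_apply hl.1 hx₀.2
    refine ⟨_, (horb (-n)).1, (horb (-n)).2, ?_⟩
    rw [zpow_neg]
    exact OrderIso.inv_apply_lt_iff.2 hn
  have hnear_p' : ∀ l, p < l → ∃ w ∈ Ioo p q, f w = w ∧ w < l := by
    intro l hl
    obtain ⟨w, h1, h2, h3⟩ := hnear_p (min l x₀) ⟨lt_min hl hx₀.1, (min_le_right _ _).trans_lt hx₀.2⟩
    exact ⟨w, h1, h2, h3.trans_le (min_le_left _ _)⟩
  have hfp : f p = p := by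
    rcases lt_trichotomy (f p) p with h | h | h
    · have h' : p < f⁻¹ p := OrderIso.lt_inv_apply_iff.2 h
      obtain ⟨w, hw, hfw, hwl⟩ := hnear_p' _ h'
      rw [OrderIso.lt_inv_apply_iff, hfw] at hwl
      exact absurd hwl hw.1.not_gt
    · exact h
    · obtain ⟨w, hw, hfw, hwl⟩ := hnear_p' _ h
      have := f.lt_iff_lt.2 hw.1
      rw [hfw] at this
      exact absurd this hwl.not_gt
  have hfq : f q = q := by
    rcases lt_trichotomy (f q) q with h | h | h
    · obtain ⟨w, hw, hfw, hwl⟩ := hnear_q _ h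
      have := f.lt_iff_lt.2 hw.2
      rw [hfw] at this
      exact absurd this hwl.not_gt
    · exact h
    · have h' : f⁻¹ q < q := OrderIso.inv_apply_lt_iff.2 h
      obtain ⟨w, hw, hfw, hwl⟩ := hnear_q _ h'
      rw [OrderIso.inv_apply_lt_iff, hfw] at hwl
      exact absurd hwl hw.2.not_gt
  intro y hy
  by_contra hne
  obtain ⟨w₁, hw₁, hfw₁, hw₁y⟩ := hnear_p y hy
  obtain ⟨w₂, hw₂, hfw₂, hw₂y⟩ := hnear_q y hy.2
  obtain ⟨s, t, hst, hyst, hs, ht⟩ := IsGap.exists_of_notMem (isClosed_fixedPoints f.continuous)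
    hne hfw₁ hfw₂ hw₁y.le hw₂y.le
  have htI : t ∈ Ioo p q := ⟨hy.1.trans hyst.2, ht.trans_lt hw₂.2⟩
  have hft : f t = t := hst.right_mem
  -- The point `g t < t` is fixed by `f`, so it is not in `(s, t)`, and the whole gap lies in the
  -- fundamental domain `[g t, t]`.
  have hgts : g t ≤ s := by
    by_contra! hlt'
    refine hst.notMem (g t) ⟨hlt', hlt t htI⟩ ?_
    change f (g t) = g t
    rw [hcomm t htI, hft]
  obtain ⟨C, hC, hdist⟩ := distortion_bound hp hlt htI hg hpos hbv
  have hfix : ∀ {z}, f z = z → ∀ n : ℤ, (f ^ n) z = z := by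
    intro z hz n
    have : z ∈ globalFixed (zpowersHom (ℝ ≃o ℝ) f) := by
      rw [globalFixed_zpowersHom]
      exact hz
    simpa [zpowersHom_apply] using this (Multiplicative.ofAdd n)
  have hcommn : ∀ n : ℤ, ∀ x ∈ Ioo p q, (f ^ n) (g x) = g ((f ^ n) x) := by
    have hcinv : ∀ x ∈ Ioo p q, f⁻¹ (g x) = g (f⁻¹ x) := by
      intro x hx
      have := hcomm _ (OrderIso.apply_mem_Ioo (OrderIso.inv_apply_eq_self_iff.2 hfp)
        (OrderIso.inv_apply_eq_self_iff.2 hfq) hx)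
      rw [RelIso.apply_inv_self] at this
      rw [← this, RelIso.inv_apply_self]
    intro n x hx
    have hmem : ∀ n : ℤ, (f ^ n) x ∈ Ioo p q := fun n =>
      OrderIso.apply_mem_Ioo (hfix hfp n) (hfix hfq n) hx
    induction n using Int.induction_on with
    | zero => rfl
    | succ n ih =>
      rw [add_comm, zpow_one_add, RelIso.mul_apply, RelIso.mul_apply, ih, hcomm _ (hmem _)]
    | pred n ih =>
      have : f ^ (-(n : ℤ) - 1) = f⁻¹ * f ^ (-(n : ℤ)) := by
        rw [← zpow_neg_one, ← zpow_add]
        congr 1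
        ring
      rw [this, RelIso.mul_apply, RelIso.mul_apply, ih, hcinv _ (hmem _)]
  have hty : 0 < t - y := sub_pos.2 hyst.2
  -- With this margin the bound `2 * C` for `f ^ (-n)` on `[(f ^ n) y, t]` gives `t - y < (t - y) /
  -- 2`.
  obtain ⟨n, hn⟩ := hst.exists_lt_zpow_apply hyst.1
    (show t - (t - y) / (4 * C) < t from sub_lt_self _ (by positivity))
  have hmem := OrderIso.apply_mem_Ioo (hfix hst.left_mem n) (hfix hft n) hyst
  have := sub_le_of_distortion hp hlt htI hC hdist (hf (-n)) (hfix hfp _) (hcommn (-n))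
    (hfix hft _) (hgts.trans hmem.1.le) hmem.2 le_rfl
  rw [hfix hft, zpow_neg, RelIso.inv_apply_self] at this
  have h2 : 2 * C * (t - (f ^ n) y) < 2 * C * ((t - y) / (4 * C)) := by
    gcongr
    linarith
  have h3 : 2 * C * ((t - y) / (4 * C)) = (t - y) / 2 := by
    field_simp
    norm_num
  linarith

/-- `f` restricts to a `C¹` map of `[p, q]` with positive derivative of bounded variation. -/
structure IsRegularOn (f : ℝ ≃o ℝ) (p q : ℝ) : Prop where
  contDiffOn : ContDiffOn ℝ 1 f (Icc p q)
  deriv_pos : ∀ x ∈ Icc p q, 0 < derivWithin f (Icc p q) x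
  bv : BoundedVariationOn (derivWithin f (Icc p q)) (Icc p q)

/-- **Kopell's lemma**, for groups of diffeomorphisms with derivatives of bounded variation. -/
theorem kopellProperty_of_isRegularOn {G : Subgroup (ℝ ≃o ℝ)}
    (hG : ∀ f ∈ G, ∀ g ∈ G, ∀ p q, IsGap (Function.fixedPoints g) p q → IsRegularOn f p q) :
    KopellProperty G := by
  intro f hf g hg p q hgap hcomm x₀ hx₀ hfx₀
  have hfn : ∀ n : ℤ, ContDiffOn ℝ 1 (f ^ n : ℝ ≃o ℝ) (Icc p q) := fun n =>
    (hG _ (G.zpow_mem hf n) g hg p q hgap).contDiffOn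
  rcases lt_or_gt_of_ne (show g x₀ ≠ x₀ from hgap.notMem x₀ hx₀) with hlt | hgt
  · have hlt' : ∀ x ∈ Ioo p q, g x < x := by
      intro x hx
      by_contra! hle
      have hlt2 : x < g x := hle.lt_of_ne fun h => hgap.notMem x hx h.symm
      exact lt_asymm hlt (OrderIso.forall_lt_of_lt_of_ne (fun y hy => hgap.notMem y hy) hx hlt2 x₀ hx₀)
    have hr := hG g hg g hg p q hgap
    exact kopell_of_lt hgap hlt' hcomm hx₀ hfx₀ hr.contDiffOn hr.deriv_pos hr.bv hfn
  · have hgap' : IsGap (Function.fixedPoints (g⁻¹ : ℝ ≃o ℝ)) p q := by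
      have : Function.fixedPoints (g⁻¹ : ℝ ≃o ℝ) = Function.fixedPoints g := by
        ext x
        exact OrderIso.inv_apply_eq_self_iff
      rwa [this]
    have hlt' : ∀ x ∈ Ioo p q, g⁻¹ x < x := fun x hx => OrderIso.inv_apply_lt_iff.2
      (OrderIso.forall_lt_of_lt_of_ne (fun y hy => hgap.notMem y hy) hx₀ hgt x hx)
    have hr := hG _ (G.inv_mem hg) _ (G.inv_mem hg) p q hgap'
    refine kopell_of_lt hgap' hlt' ?_ hx₀ hfx₀ hr.contDiffOn hr.deriv_pos hr.bv hfn
    intro x hx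
    have := hcomm _ (OrderIso.apply_mem_Ioo hgap'.left_mem hgap'.right_mem hx)
    rw [RelIso.apply_inv_self] at this
    rw [this, RelIso.inv_apply_self]

/-! ### The right-angled Artin group of the path on four vertices -/

lemma commute_genP4 {v w : P4Vertex} (h : pathP4.Adj v w) : Commute (genP4 v) (genP4 w) := by
  rw [← commutatorElement_eq_one_iff_commute]
  exact PresentedGroup.one_of_mem ⟨v, w, h, rfl⟩

lemma commute_genP4_b_d : Commute (genP4 P4Vertex.b) (genP4 P4Vertex.d) :=
  commute_genP4 (by simp [pathP4])

lemma commute_genP4_d_a : Commute (genP4 P4Vertex.d) (genP4 P4Vertex.a) :=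
  commute_genP4 (by simp [pathP4])

lemma commute_genP4_a_c : Commute (genP4 P4Vertex.a) (genP4 P4Vertex.c) :=
  commute_genP4 (by simp [pathP4])

/-- A homomorphism from `A(P₄)` is determined by four elements, subject to three commutation
relations. -/
lemma exists_hom_artinP4 {G : Type*} [Group G] (h : P4Vertex → G)
    (hbd : Commute (h P4Vertex.b) (h P4Vertex.d)) (hda : Commute (h P4Vertex.d) (h P4Vertex.a))
    (hac : Commute (h P4Vertex.a) (h P4Vertex.c)) :
    ∃ F : RightAngledArtinGroup pathP4 →* G, ∀ v, F (genP4 v) = h v := by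
  refine ⟨PresentedGroup.toGroup (f := h) ?_, fun v => PresentedGroup.toGroup.of _⟩
  rintro _ ⟨v, w, hvw, rfl⟩
  rw [map_commutatorElement, commutatorElement_eq_one_iff_commute]
  simp only [FreeGroup.lift_apply_of]
  simp only [pathP4, SimpleGraph.fromEdgeSet_adj, mem_insert_iff, mem_singleton_iff,
    Sym2.eq_iff] at hvw
  rcases hvw with ⟨(⟨rfl, rfl⟩ | ⟨rfl, rfl⟩) | (⟨rfl, rfl⟩ | ⟨rfl, rfl⟩) |
    (⟨rfl, rfl⟩ | ⟨rfl, rfl⟩), -⟩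
  exacts [hbd, hbd.symm, hda, hda.symm, hac, hac.symm]

lemma genP4_d_ne_one : genP4 P4Vertex.d ≠ 1 := by
  obtain ⟨F, hF⟩ := exists_hom_artinP4 (G := FreeGroup Unit)
    (fun v => P4Vertex.rec 1 1 1 (FreeGroup.of ()) v) (Commute.one_left _) (Commute.one_right _)
    (Commute.one_left _)
  intro h
  have := hF P4Vertex.d
  rw [h, map_one] at this
  exact FreeGroup.one_ne_of () this

lemma exists_retraction_a_b : ∃ F : RightAngledArtinGroup pathP4 →* FreeGroup Bool,
    F (genP4 P4Vertex.a) = FreeGroup.of true ∧ F (genP4 P4Vertex.b) = FreeGroup.of false := by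
  obtain ⟨F, hF⟩ := exists_hom_artinP4 (G := FreeGroup Bool)
    (fun v => P4Vertex.rec (FreeGroup.of true) (FreeGroup.of false) 1 1 v) (Commute.one_right _)
    (Commute.one_left _) (Commute.one_right _)
  exact ⟨F, hF _, hF _⟩

/-- Pairs of elements of `Q` act on two copies of `Q` by left multiplication. -/
def doubleLeftMul (Q : Type*) [Group Q] : Q × Q →* Equiv.Perm (Bool × Q) where
  toFun u :=
    { toFun := fun x => (x.1, (bif x.1 then u.1 else u.2) * x.2)
      invFun := fun x => (x.1, (bif x.1 then u.1 else u.2)⁻¹ * x.2)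
      left_inv := fun x => by simp
      right_inv := fun x => by simp }
  map_one' := by
    ext ⟨i, q⟩ <;> cases i <;> simp
  map_mul' u v := by
    ext ⟨i, q⟩ <;> cases i <;> simp [mul_assoc]

/-- Exchange of the two copies of `Q`. -/
def swapCopies (Q : Type*) : Equiv.Perm (Bool × Q) :=
  Equiv.prodCongr Equiv.boolNot (Equiv.refl Q)

lemma swapCopies_conj {Q : Type*} [Group Q] (u v : Q) :
    swapCopies Q * doubleLeftMul Q (u, v) * (swapCopies Q)⁻¹ = doubleLeftMul Q (v, u) := by
  rw [mul_inv_eq_iff_eq_mul]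
  ext ⟨i, q⟩ <;> cases i <;> simp [swapCopies, doubleLeftMul]

/-- The homomorphism from the free group of rank three onto the subgroup of `A(P₄)` generated by
`b a b⁻¹`, `c` and `d`. -/
def conjSubgroupHom : FreeGroup (Fin 3) →* RightAngledArtinGroup pathP4 :=
  FreeGroup.lift ![genP4 P4Vertex.b * genP4 P4Vertex.a * (genP4 P4Vertex.b)⁻¹, genP4 P4Vertex.c,
    genP4 P4Vertex.d]

/-- The map from the free group of rank three to that of rank two sending the generators to
`r, s, r`. -/
def foldHom : FreeGroup (Fin 3) →* FreeGroup Bool :=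
  FreeGroup.lift ![FreeGroup.of true, FreeGroup.of false, FreeGroup.of true]

/-- The map `foldHom` factors through the subgroup generated by `b a b⁻¹`, `c` and `d`. -/
lemma foldHom_eq_one {w : FreeGroup (Fin 3)} (hw : conjSubgroupHom w = 1) : foldHom w = 1 := by
  set r : FreeGroup Bool := FreeGroup.of true
  set s : FreeGroup Bool := FreeGroup.of false
  let D := doubleLeftMul (FreeGroup Bool)
  -- A wreath product representation: `a` acts by `r` on the second copy, `c` by `s` on the first,
  -- `d` by `r` on both, and `b` exchanges the copies. Then `b a b⁻¹` acts by `r` on the first copy,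
  -- where `b a b⁻¹, c, d` act as `r, s, r`.
  obtain ⟨F, hF⟩ := exists_hom_artinP4 (G := Equiv.Perm (Bool × FreeGroup Bool))
    (fun v => P4Vertex.rec (D (1, r)) (swapCopies _) (D (s, 1)) (D (r, r)) v)
    (mul_inv_eq_iff_eq_mul.1 (swapCopies_conj r r))
    ((show Commute (r, r) (1, r) from Prod.ext (by simp) rfl).map D)
    ((show Commute (1, r) (s, 1) from Prod.ext (by simp) (by simp)).map D)
  let ρ' : FreeGroup (Fin 3) →* FreeGroup Bool := FreeGroup.lift ![1, 1, r]
  have key : F.comp conjSubgroupHom = D.comp (foldHom.prod ρ') := by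
    ext i : 1
    fin_cases i
    · simp only [conjSubgroupHom, foldHom, ρ', MonoidHom.comp_apply, MonoidHom.prod_apply,
        FreeGroup.lift_apply_of, Fin.zero_eta, Matrix.cons_val_zero, map_mul, map_inv, hF]
      exact swapCopies_conj 1 r
    · simp [conjSubgroupHom, foldHom, ρ', hF, s]
    · simp [conjSubgroupHom, foldHom, ρ', hF, r]
  have h1 := DFunLike.congr_fun key w
  rw [MonoidHom.comp_apply, hw, map_one, MonoidHom.comp_apply] at h1
  have h2 := congrArg Prod.snd (DFunLike.congr_fun h1 (true, 1))
  simpa [D, doubleLeftMul] using h2.symm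

lemma FreeGroup.commutator_of_ne_one {α : Type*} {x y : α} (h : x ≠ y) :
    ⁅FreeGroup.of x, FreeGroup.of y⁆ ≠ 1 := by
  rw [Ne, commutatorElement_eq_one_iff_commute]
  intro hc
  exact FreeGroup.of_ne_one x (FreeGroup.eq_one_of_commute_of h (Commute.refl _) hc)

/-- The commutator of `b a b⁻¹` and `c⁻¹ d c`. -/
def conjCommutator : FreeGroup (Fin 3) :=
  ⁅FreeGroup.of (0 : Fin 3), (FreeGroup.of 1)⁻¹ * FreeGroup.of 2 * FreeGroup.of 1⁆

/-- The image is the commutator of `r` with its conjugate `s⁻¹ r s`; were it trivial, `r` would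
commute with `s`. -/
lemma foldHom_conjCommutator_ne_one : foldHom conjCommutator ≠ 1 := by
  simp only [conjCommutator, foldHom, map_commutatorElement, map_mul, map_inv,
    FreeGroup.lift_apply_of, Matrix.cons_val_zero, Matrix.cons_val_one, Matrix.cons_val]
  rw [Ne, commutatorElement_eq_one_iff_commute]
  intro h
  have h2 := IsFreeGroup.commute_of_commute_conj (u := FreeGroup.of true)
    (g := (FreeGroup.of false)⁻¹) (by rwa [inv_inv])
  exact FreeGroup.commutator_of_ne_one (x := true) (y := false) (by simp)
    (commutatorElement_eq_one_iff_commute.2 (Commute.inv_right_iff.1 h2))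

/-! ### Chains of support components -/

/-- Position of the support components of `B` and `C` when `B` moves a point `z` to the right out
of `(p, q)`, and `C` moves `B z` into `(r, s)`. -/
lemma chain_right {B C : ℝ ≃o ℝ} {b₁ b₂ c₁ c₂ p q r s z : ℝ}
    (hB : IsGap (Function.fixedPoints B) b₁ b₂) (hC : IsGap (Function.fixedPoints C) c₁ c₂)
    (hzP : z ∈ Ioo p q) (hzR : C (B z) ∈ Ioo r s) (hzB : z ∈ Ioo b₁ b₂) (hzC : B z ∈ Ioo c₁ c₂)
    (hPC : Disjoint (Ioo p q) (Ioo c₁ c₂)) (hRB : Disjoint (Ioo r s) (Ioo b₁ b₂))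
    (hlt : z < B z) :
    q ∈ Ioo b₁ b₂ ∧ B q ∈ Ioo c₁ c₂ ∧ r ∈ Ioo c₁ c₂ ∧ C⁻¹ r ∈ Ioo b₁ b₂ ∧
      B z ∈ Icc (C⁻¹ b₂) (B c₁) ∧ Icc (C⁻¹ b₂) (B c₁) ⊆ Ioo c₁ c₂ := by
  have hb₁ : B b₁ = b₁ := hB.left_mem
  have hb₂ : B b₂ = b₂ := hB.right_mem
  have hc₁ : C c₁ = c₁ := hC.left_mem
  have hc₂ : C c₂ = c₂ := hC.right_mem
  have hBz := OrderIso.apply_mem_Ioo hb₁ hb₂ hzB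
  have hCz := OrderIso.apply_mem_Ioo hc₁ hc₂ hzC
  -- The order on the line is `q ≤ c₁ < B z < b₂ ≤ r`. Thus `q` and `B q` single out the components
  -- of `B` and `C`, and so do `C⁻¹ r` and `r`; this makes the interval around `B z` depend on one
  -- end of the chain only.
  have hzc₁ : z ≤ c₁ := by
    by_contra! h
    exact disjoint_left.1 hPC hzP ⟨h, hlt.trans hzC.2⟩
  have hb₂C : b₂ ≤ C (B z) := by
    by_contra! h
    exact disjoint_left.1 hRB hzR ⟨(hzB.1.trans_le hzc₁).trans hCz.1, h⟩
  have hqc₁ : q ≤ c₁ := by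
    by_contra! h
    obtain ⟨w, hw, hw'⟩ := exists_between (lt_min h (hzC.1.trans hzC.2))
    exact disjoint_left.1 hPC ⟨hzP.1.trans_le (hzc₁.trans hw.le), hw'.trans_le (min_le_left _ _)⟩
      ⟨hw, hw'.trans_le (min_le_right _ _)⟩
  have hrb₂ : b₂ ≤ r := by
    by_contra! h
    obtain ⟨w, hw, hw'⟩ := exists_between (max_lt h (hzB.1.trans hzB.2))
    exact disjoint_left.1 hRB ⟨(le_max_left _ _).trans_lt hw, hw'.trans (hb₂C.trans_lt hzR.2)⟩
      ⟨(le_max_right _ _).trans_lt hw, hw'⟩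
  have hc₁b₂ : c₁ < b₂ := hzC.1.trans hBz.2
  have hb₂c₂ : b₂ < c₂ := hb₂C.trans_lt hCz.2
  have hBc₁ : B c₁ < b₂ := by
    rw [← hb₂]
    exact B.lt_iff_lt.2 hc₁b₂
  have hBzc : B z ≤ B c₁ := B.le_iff_le.2 hzc₁
  have hCb₂ : c₁ < C⁻¹ b₂ := by
    rw [OrderIso.lt_inv_apply_iff, hc₁]
    exact hc₁b₂
  refine ⟨⟨hzB.1.trans hzP.2, hqc₁.trans_lt hc₁b₂⟩, ⟨hzC.1.trans (B.lt_iff_lt.2 hzP.2),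
    (B.le_iff_le.2 hqc₁).trans_lt (hBc₁.trans hb₂c₂)⟩, ⟨hc₁b₂.trans_le hrb₂, hzR.1.trans hCz.2⟩,
    ⟨?_, ?_⟩, ⟨OrderIso.inv_apply_le_iff.2 hb₂C, hBzc⟩, ?_⟩
  · refine (hzB.1.trans_le hzc₁).trans (hCb₂.trans_le ?_)
    rw [OrderIso.le_inv_apply_iff, RelIso.apply_inv_self]
    exact hrb₂
  · exact (OrderIso.inv_apply_lt_iff.2 hzR.1).trans hBz.2
  · exact Icc_subset_Ioo hCb₂ (hBc₁.trans hb₂c₂)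

/-- Mirror image of `chain_right`, with the order `s ≤ b₁ < B z < c₂ ≤ p`. -/
lemma chain_left {B C : ℝ ≃o ℝ} {b₁ b₂ c₁ c₂ p q r s z : ℝ}
    (hB : IsGap (Function.fixedPoints B) b₁ b₂) (hC : IsGap (Function.fixedPoints C) c₁ c₂)
    (hzP : z ∈ Ioo p q) (hzR : C (B z) ∈ Ioo r s) (hzB : z ∈ Ioo b₁ b₂) (hzC : B z ∈ Ioo c₁ c₂)
    (hPC : Disjoint (Ioo p q) (Ioo c₁ c₂)) (hRB : Disjoint (Ioo r s) (Ioo b₁ b₂))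
    (hlt : B z < z) :
    p ∈ Ioo b₁ b₂ ∧ B p ∈ Ioo c₁ c₂ ∧ s ∈ Ioo c₁ c₂ ∧ C⁻¹ s ∈ Ioo b₁ b₂ ∧
      B z ∈ Icc (B c₂) (C⁻¹ b₁) ∧ Icc (B c₂) (C⁻¹ b₁) ⊆ Ioo c₁ c₂ := by
  have hb₁ : B b₁ = b₁ := hB.left_mem
  have hb₂ : B b₂ = b₂ := hB.right_mem
  have hc₁ : C c₁ = c₁ := hC.left_mem
  have hc₂ : C c₂ = c₂ := hC.right_mem
  have hBz := OrderIso.apply_mem_Ioo hb₁ hb₂ hzB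
  have hCz := OrderIso.apply_mem_Ioo hc₁ hc₂ hzC
  have hzc₂ : c₂ ≤ z := by
    by_contra! h
    exact disjoint_left.1 hPC hzP ⟨hzC.1.trans hlt, h⟩
  have hb₁C : C (B z) ≤ b₁ := by
    by_contra! h
    exact disjoint_left.1 hRB hzR ⟨h, hCz.2.trans (hzc₂.trans_lt hzB.2)⟩
  have hpc₂ : c₂ ≤ p := by
    by_contra! h
    obtain ⟨w, hw, hw'⟩ := exists_between (max_lt h (hzC.1.trans hzC.2))
    exact disjoint_left.1 hPC ⟨(le_max_left _ _).trans_lt hw, (hw'.le.trans hzc₂).trans_lt hzP.2⟩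
      ⟨(le_max_right _ _).trans_lt hw, hw'⟩
  have hsb₁ : s ≤ b₁ := by
    by_contra! h
    obtain ⟨w, hw, hw'⟩ := exists_between (lt_min h (hzB.1.trans hzB.2))
    exact disjoint_left.1 hRB ⟨(hzR.1.trans_le hb₁C).trans hw, hw'.trans_le (min_le_left _ _)⟩
      ⟨hw, hw'.trans_le (min_le_right _ _)⟩
  have hb₁c₂ : b₁ < c₂ := hBz.1.trans hzC.2
  have hc₁b₁ : c₁ < b₁ := hCz.1.trans_le hb₁C
  have hBc₂ : b₁ < B c₂ := by
    rw [← hb₁]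
    exact B.lt_iff_lt.2 hb₁c₂
  have hBzc : B c₂ ≤ B z := B.le_iff_le.2 hzc₂
  have hCb₁ : C⁻¹ b₁ < c₂ := by
    rw [OrderIso.inv_apply_lt_iff, hc₂]
    exact hb₁c₂
  refine ⟨⟨hb₁c₂.trans_le hpc₂, hzP.1.trans hzB.2⟩, ⟨(hc₁b₁.trans hBc₂).trans_le
    (B.le_iff_le.2 hpc₂), (B.lt_iff_lt.2 hzP.1).trans hzC.2⟩, ⟨hCz.1.trans hzR.2, hsb₁.trans_lt hb₁c₂⟩,
    ⟨?_, ?_⟩, ⟨hBzc, OrderIso.le_inv_apply_iff.2 hb₁C⟩, ?_⟩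
  · exact hBz.1.trans (OrderIso.lt_inv_apply_iff.2 hzR.2)
  · refine lt_of_le_of_lt ?_ (hCb₁.trans_le (hzc₂.trans hzB.2.le))
    rw [OrderIso.inv_apply_le_iff, RelIso.apply_inv_self]
    exact hsb₁
  · exact Icc_subset_Ioo (hc₁b₁.trans hBc₂) hCb₁

/-- An action of `A(P₄)` on the line whose image has the Kopell property, the generators having
unbounded fixed point sets. -/
structure IsKopellAction (ψ : RightAngledArtinGroup pathP4 →* (ℝ ≃o ℝ)) : Prop where
  kopell : KopellProperty ψ.range
  unboundedFixed : ∀ v, UnboundedFixed (ψ (genP4 v))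

open P4Vertex in
/-- `z` is a point of the component `P` of the support of `a` which is mapped by `c b` to the
component `R ≠ P` of the support of `d`. -/
structure IsTransition (ψ : RightAngledArtinGroup pathP4 →* (ℝ ≃o ℝ)) (P R : ℝ × ℝ) (z : ℝ) :
    Prop where
  isGap_a : IsGap (Function.fixedPoints (ψ (genP4 a))) P.1 P.2
  isGap_d : IsGap (Function.fixedPoints (ψ (genP4 d))) R.1 R.2
  ne : P ≠ R
  mem_a : z ∈ Ioo P.1 P.2
  mem_d : ψ (genP4 c) (ψ (genP4 b) z) ∈ Ioo R.1 R.2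

namespace IsKopellAction

variable {ψ : RightAngledArtinGroup pathP4 →* (ℝ ≃o ℝ)}

open P4Vertex

lemma mem_range (v : P4Vertex) : ψ (genP4 v) ∈ ψ.range := ⟨_, rfl⟩

/-- Since `a` and `d` commute, `P` and `R` are disjoint. If `b` fixed `z`, then `c` would carry `z`
from `P` to `R`; but the component of `c` through `z` would have to be `P`. If `(b₁, b₂)` met `R`,
it would equal `R` and contain `z`; hence `b z` is not in `R`, and `c` moves it. If `(c₁, c₂)` met
`P`, it would equal `P` and contain `c b z`. -/
lemma exists_chain (h : IsKopellAction ψ) {P R : ℝ × ℝ} {z : ℝ} (e : IsTransition ψ P R z) :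
    ∃ b₁ b₂ c₁ c₂, IsGap (Function.fixedPoints (ψ (genP4 b))) b₁ b₂ ∧
      IsGap (Function.fixedPoints (ψ (genP4 c))) c₁ c₂ ∧ z ∈ Ioo b₁ b₂ ∧
      ψ (genP4 b) z ∈ Ioo c₁ c₂ ∧ Disjoint (Ioo P.1 P.2) (Ioo c₁ c₂) ∧
      Disjoint (Ioo R.1 R.2) (Ioo b₁ b₂) := by
  have eqAD := fun x => h.kopell.eq_of_mem (x := x) (mem_range a) (mem_range d)
    (commute_genP4_d_a.symm.map ψ) e.isGap_a e.isGap_d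
  have hnot : ∀ x ∈ Ioo P.1 P.2, x ∉ Ioo R.1 R.2 := fun x hx hx' =>
    e.ne (Prod.ext (eqAD x hx hx').1 (eqAD x hx hx').2)
  have eqAC := fun c₁ c₂ x => h.kopell.eq_of_mem (p' := c₁) (q' := c₂) (x := x) (mem_range a)
    (mem_range c) (commute_genP4_a_c.map ψ) e.isGap_a
  have eqDB := fun b₁ b₂ x => h.kopell.eq_of_mem (p' := b₁) (q' := b₂) (x := x) (mem_range d)
    (mem_range b) (commute_genP4_b_d.symm.map ψ) e.isGap_d
  have hbz : ψ (genP4 b) z ≠ z := by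
    intro hbz
    have he := e.mem_d
    rw [hbz] at he
    by_cases hcz : ψ (genP4 c) z = z
    · rw [hcz] at he
      exact hnot z e.mem_a he
    · obtain ⟨c₁, c₂, hC, hz⟩ := (h.unboundedFixed c).exists_isGap hcz
      obtain ⟨rfl, rfl⟩ := eqAC c₁ c₂ z hC e.mem_a hz
      exact hnot _ (OrderIso.apply_mem_Ioo hC.left_mem hC.right_mem hz) he
  obtain ⟨b₁, b₂, hB, hz⟩ := (h.unboundedFixed b).exists_isGap hbz
  have hBz := OrderIso.apply_mem_Ioo hB.left_mem hB.right_mem hz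
  have hRB : Disjoint (Ioo R.1 R.2) (Ioo b₁ b₂) := by
    rw [disjoint_left]
    intro x hx hx'
    obtain ⟨h1, h2⟩ := eqDB b₁ b₂ x hB hx hx'
    rw [← h1, ← h2] at hz
    exact hnot z e.mem_a hz
  have hcz : ψ (genP4 c) (ψ (genP4 b) z) ≠ ψ (genP4 b) z := by
    intro hcz
    have he := e.mem_d
    rw [hcz] at he
    exact disjoint_left.1 hRB he hBz
  obtain ⟨c₁, c₂, hC, hz'⟩ := (h.unboundedFixed c).exists_isGap hcz
  refine ⟨b₁, b₂, c₁, c₂, hB, hC, hz, hz', ?_, hRB⟩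
  rw [disjoint_left]
  intro x hx hx'
  obtain ⟨h1, h2⟩ := eqAC c₁ c₂ x hC hx hx'
  have h3 := OrderIso.apply_mem_Ioo hC.left_mem hC.right_mem hz'
  rw [← h1, ← h2] at h3
  exact hnot _ h3 e.mem_d

lemma notMem_fixedPoints_of_subset {f : ℝ ≃o ℝ} {p q : ℝ} {K : Set ℝ}
    (h : IsGap (Function.fixedPoints f) p q) (hK : K ⊆ Ioo p q) : ∀ x ∈ K, f x ≠ x :=
  fun x hx => h.notMem x (hK hx)

/-- Transitions from a fixed component of the support of `a` pass through a compact subset of the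
support of `c`. -/
lemma exists_compact_of_a (h : IsKopellAction ψ) (P : ℝ × ℝ) :
    ∃ K, IsCompact K ∧ (∀ x ∈ K, ψ (genP4 c) x ≠ x) ∧
      ∀ R z, IsTransition ψ P R z → ψ (genP4 b) z ∈ K := by
  have hr : ∃ K, IsCompact K ∧ (∀ x ∈ K, ψ (genP4 c) x ≠ x) ∧
      ∀ R z, IsTransition ψ P R z → z < ψ (genP4 b) z → ψ (genP4 b) z ∈ K := by
    by_cases hex : ∃ R z, IsTransition ψ P R z ∧ z < ψ (genP4 b) z
    · obtain ⟨R, z, e, hlt⟩ := hex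
      obtain ⟨b₁, b₂, c₁, c₂, hB, hC, h1, h2, h3, h4⟩ := h.exists_chain e
      obtain ⟨k1, k2, k3, k4, k5, k6⟩ := chain_right hB hC e.mem_a e.mem_d h1 h2 h3 h4 hlt
      refine ⟨_, isCompact_Icc, notMem_fixedPoints_of_subset hC k6, fun R' z' e' hlt' => ?_⟩
      obtain ⟨b₁', b₂', c₁', c₂', hB', hC', h1', h2', h3', h4'⟩ := h.exists_chain e'
      obtain ⟨k1', k2', k3', k4', k5', k6'⟩ :=
        chain_right hB' hC' e'.mem_a e'.mem_d h1' h2' h3' h4' hlt'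
      -- The component of `b` through the right end `q` of `P`, and that of `c` through `b q`, are
      -- the same for all rightward transitions from `P`.
      rw [(hB.eq_of_mem hB' k1 k1').2, (hC.eq_of_mem hC' k2 k2').1]
      exact k5'
    · push Not at hex
      exact ⟨∅, isCompact_empty, by simp, fun R z e hlt => absurd hlt (hex R z e).not_gt⟩
  have hl : ∃ K, IsCompact K ∧ (∀ x ∈ K, ψ (genP4 c) x ≠ x) ∧
      ∀ R z, IsTransition ψ P R z → ψ (genP4 b) z < z → ψ (genP4 b) z ∈ K := by
    by_cases hex : ∃ R z, IsTransition ψ P R z ∧ ψ (genP4 b) z < z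
    · obtain ⟨R, z, e, hlt⟩ := hex
      obtain ⟨b₁, b₂, c₁, c₂, hB, hC, h1, h2, h3, h4⟩ := h.exists_chain e
      obtain ⟨k1, k2, k3, k4, k5, k6⟩ := chain_left hB hC e.mem_a e.mem_d h1 h2 h3 h4 hlt
      refine ⟨_, isCompact_Icc, notMem_fixedPoints_of_subset hC k6, fun R' z' e' hlt' => ?_⟩
      obtain ⟨b₁', b₂', c₁', c₂', hB', hC', h1', h2', h3', h4'⟩ := h.exists_chain e'
      obtain ⟨k1', k2', k3', k4', k5', k6'⟩ :=
        chain_left hB' hC' e'.mem_a e'.mem_d h1' h2' h3' h4' hlt'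
      rw [(hB.eq_of_mem hB' k1 k1').1, (hC.eq_of_mem hC' k2 k2').2]
      exact k5'
    · push Not at hex
      exact ⟨∅, isCompact_empty, by simp, fun R z e hlt => absurd hlt (hex R z e).not_gt⟩
  obtain ⟨K, hK, hKc, hK'⟩ := hr
  obtain ⟨L, hL, hLc, hL'⟩ := hl
  refine ⟨K ∪ L, hK.union hL, fun x hx => hx.elim (hKc x) (hLc x), fun R z e => ?_⟩
  obtain ⟨b₁, b₂, c₁, c₂, hB, hC, h1, h2, h3, h4⟩ := h.exists_chain e
  rcases lt_or_gt_of_ne (hB.notMem z h1) with hlt | hlt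
  · exact Or.inr (hL' R z e hlt)
  · exact Or.inl (hK' R z e hlt)

/-- Transitions into a fixed component of the support of `d` pass through a compact subset of the
support of `c`. -/
lemma exists_compact_of_d (h : IsKopellAction ψ) (R : ℝ × ℝ) :
    ∃ K, IsCompact K ∧ (∀ x ∈ K, ψ (genP4 c) x ≠ x) ∧
      ∀ P z, IsTransition ψ P R z → ψ (genP4 b) z ∈ K := by
  have hr : ∃ K, IsCompact K ∧ (∀ x ∈ K, ψ (genP4 c) x ≠ x) ∧
      ∀ P z, IsTransition ψ P R z → z < ψ (genP4 b) z → ψ (genP4 b) z ∈ K := by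
    by_cases hex : ∃ P z, IsTransition ψ P R z ∧ z < ψ (genP4 b) z
    · obtain ⟨P, z, e, hlt⟩ := hex
      obtain ⟨b₁, b₂, c₁, c₂, hB, hC, h1, h2, h3, h4⟩ := h.exists_chain e
      obtain ⟨k1, k2, k3, k4, k5, k6⟩ := chain_right hB hC e.mem_a e.mem_d h1 h2 h3 h4 hlt
      refine ⟨_, isCompact_Icc, notMem_fixedPoints_of_subset hC k6, fun P' z' e' hlt' => ?_⟩
      obtain ⟨b₁', b₂', c₁', c₂', hB', hC', h1', h2', h3', h4'⟩ := h.exists_chain e'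
      obtain ⟨k1', k2', k3', k4', k5', k6'⟩ :=
        chain_right hB' hC' e'.mem_a e'.mem_d h1' h2' h3' h4' hlt'
      -- Now the left end `r` of `R` selects the component of `c`, and `c⁻¹ r` that of `b`.
      rw [(hB.eq_of_mem hB' k4 k4').2, (hC.eq_of_mem hC' k3 k3').1]
      exact k5'
    · push Not at hex
      exact ⟨∅, isCompact_empty, by simp, fun P z e hlt => absurd hlt (hex P z e).not_gt⟩
  have hl : ∃ K, IsCompact K ∧ (∀ x ∈ K, ψ (genP4 c) x ≠ x) ∧
      ∀ P z, IsTransition ψ P R z → ψ (genP4 b) z < z → ψ (genP4 b) z ∈ K := by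
    by_cases hex : ∃ P z, IsTransition ψ P R z ∧ ψ (genP4 b) z < z
    · obtain ⟨P, z, e, hlt⟩ := hex
      obtain ⟨b₁, b₂, c₁, c₂, hB, hC, h1, h2, h3, h4⟩ := h.exists_chain e
      obtain ⟨k1, k2, k3, k4, k5, k6⟩ := chain_left hB hC e.mem_a e.mem_d h1 h2 h3 h4 hlt
      refine ⟨_, isCompact_Icc, notMem_fixedPoints_of_subset hC k6, fun P' z' e' hlt' => ?_⟩
      obtain ⟨b₁', b₂', c₁', c₂', hB', hC', h1', h2', h3', h4'⟩ := h.exists_chain e'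
      obtain ⟨k1', k2', k3', k4', k5', k6'⟩ :=
        chain_left hB' hC' e'.mem_a e'.mem_d h1' h2' h3' h4' hlt'
      rw [(hB.eq_of_mem hB' k4 k4').1, (hC.eq_of_mem hC' k3 k3').2]
      exact k5'
    · push Not at hex
      exact ⟨∅, isCompact_empty, by simp, fun P z e hlt => absurd hlt (hex P z e).not_gt⟩
  obtain ⟨K, hK, hKc, hK'⟩ := hr
  obtain ⟨L, hL, hLc, hL'⟩ := hl
  refine ⟨K ∪ L, hK.union hL, fun x hx => hx.elim (hKc x) (hLc x), fun P z e => ?_⟩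
  obtain ⟨b₁, b₂, c₁, c₂, hB, hC, h1, h2, h3, h4⟩ := h.exists_chain e
  rcases lt_or_gt_of_ne (hB.notMem z h1) with hlt | hlt
  · exact Or.inr (hL' P z e hlt)
  · exact Or.inl (hK' P z e hlt)

/-- On a common component of the supports of `a` and `d`, the maps `b a b⁻¹` and `c⁻¹ d c` agree
with `a` and `d`. -/
lemma conj_apply_of_common (h : IsKopellAction ψ) {p q w : ℝ}
    (ha : IsGap (Function.fixedPoints (ψ (genP4 a))) p q)
    (hd : IsGap (Function.fixedPoints (ψ (genP4 d))) p q) (hw : w ∈ Ioo p q) :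
    ψ (genP4 b) (ψ (genP4 a) ((ψ (genP4 b))⁻¹ w)) = ψ (genP4 a) w ∧
      (ψ (genP4 c))⁻¹ (ψ (genP4 d) (ψ (genP4 c) w)) = ψ (genP4 d) w := by
  have eb := h.kopell.apply_endpoints (mem_range d) (mem_range b)
    (commute_genP4_b_d.symm.map ψ) (h.unboundedFixed b) hd
  constructor
  · have hw' : (ψ (genP4 b))⁻¹ w ∈ Ioo p q := OrderIso.apply_mem_Ioo
      (OrderIso.inv_apply_eq_self_iff.2 eb.1) (OrderIso.inv_apply_eq_self_iff.2 eb.2) hw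
    -- Both `b` and `a` centralize `d`, so they commute on its component; in the second half `d` and
    -- `c` both centralize `a`.
    rw [h.kopell.comm_of_commute (mem_range b) (mem_range a) (mem_range d)
      (commute_genP4_b_d.map ψ) (commute_genP4_d_a.symm.map ψ) (h.unboundedFixed b)
      (h.unboundedFixed a) hd hw', RelIso.apply_inv_self]
  · rw [h.kopell.comm_of_commute (mem_range d) (mem_range c) (mem_range a)
      (commute_genP4_d_a.map ψ) (commute_genP4_a_c.symm.map ψ) (h.unboundedFixed d)
      (h.unboundedFixed c) ha hw, RelIso.inv_apply_self]

/-- If all transitions in `[o, o']` involve finitely many components of the support of `a` or of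
the support of `d`, then the action on `[o, o']` is not faithful. -/
lemma not_faithful_of_finite (h : IsKopellAction ψ) {o o' : ℝ} (ho : o ∈ globalFixed ψ)
    (ho' : o' ∈ globalFixed ψ) (S T : Finset (ℝ × ℝ))
    (hST : ∀ P R z, z ∈ Icc o o' → IsTransition ψ P R z → P ∈ S ∨ R ∈ T) :
    ∃ g ≠ 1, ∀ x ∈ Icc o o', ψ g x = x := by
  choose K hK hKc hKe using h.exists_compact_of_a
  choose L hL hLc hLe using h.exists_compact_of_d
  set K₀ : Set ℝ := (⋃ P ∈ S, K P) ∪ ⋃ R ∈ T, L R with hK₀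
  have hK₀compact : IsCompact K₀ :=
    (S.isCompact_biUnion fun P _ => hK P).union (T.isCompact_biUnion fun R _ => hL R)
  have hK₀c : ∀ x ∈ K₀, ψ (genP4 c) x ≠ x := by
    rintro x (hx | hx)
    · obtain ⟨P, -, hP⟩ := mem_iUnion₂.1 hx
      exact hKc P x hP
    · obtain ⟨R, -, hR⟩ := mem_iUnion₂.1 hx
      exact hLc R x hR
  set Ψ := ψ.comp conjSubgroupHom with hΨ
  have hΨ1 : Ψ (FreeGroup.of 1) = ψ (genP4 c) := by
    simp [hΨ, conjSubgroupHom]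
  set x := Ψ (FreeGroup.of 0) with hx
  set y := Ψ ((FreeGroup.of 1)⁻¹ * FreeGroup.of 2 * FreeGroup.of 1) with hy
  have hx' : ∀ w, x w = ψ (genP4 b) (ψ (genP4 a) ((ψ (genP4 b))⁻¹ w)) := by
    intro w
    simp only [hx, hΨ, conjSubgroupHom, MonoidHom.comp_apply, FreeGroup.lift_apply_of,
      Matrix.cons_val_zero, map_mul, map_inv, RelIso.mul_apply]
  have hy' : ∀ w, y w = (ψ (genP4 c))⁻¹ (ψ (genP4 d) (ψ (genP4 c) w)) := by
    intro w
    simp only [hy, hΨ, conjSubgroupHom, MonoidHom.comp_apply, FreeGroup.lift_apply_of,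
      Matrix.cons_val_one, Matrix.cons_val, map_mul, map_inv, RelIso.mul_apply]
  -- Put `z = b⁻¹ w`: then `a` moves `z` and `d` moves `c b z`. If the two components differ, `z` is
  -- a transition and `w = b z` lies in `K₀`; if they agree, `b` preserves the common component and
  -- `w` lies in it.
  have hcommon : ∀ w ∈ Icc o o', x w ≠ w → y w ≠ w → w ∈ K₀ ∨
      ∃ p q, IsGap (Function.fixedPoints (ψ (genP4 a))) p q ∧
        IsGap (Function.fixedPoints (ψ (genP4 d))) p q ∧ w ∈ Ioo p q := by
    intro w hw hxw hyw
    set z := (ψ (genP4 b))⁻¹ w with hz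
    have hbz : ψ (genP4 b) z = w := RelIso.apply_inv_self _ _
    have haz : ψ (genP4 a) z ≠ z := by
      intro haz
      rw [hx', haz, hbz] at hxw
      exact hxw rfl
    have hdz : ψ (genP4 d) (ψ (genP4 c) w) ≠ ψ (genP4 c) w := by
      intro hdz
      rw [hy', hdz, RelIso.inv_apply_self] at hyw
      exact hyw rfl
    obtain ⟨p, q, hP, hzP⟩ := (h.unboundedFixed a).exists_isGap haz
    obtain ⟨r, s, hR, hzR⟩ := (h.unboundedFixed d).exists_isGap hdz
    by_cases hne : (p, q) = (r, s)
    · obtain ⟨rfl, rfl⟩ := Prod.mk.inj hne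
      right
      refine ⟨p, q, hP, hR, ?_⟩
      have eb := h.kopell.apply_endpoints (mem_range d) (mem_range b)
        (commute_genP4_b_d.symm.map ψ) (h.unboundedFixed b) hR
      rw [← hbz]
      exact OrderIso.apply_mem_Ioo eb.1 eb.2 hzP
    · left
      have e : IsTransition ψ (p, q) (r, s) z := ⟨hP, hR, hne, hzP, by rwa [hbz]⟩
      have hzI : z ∈ Icc o o' := OrderIso.apply_mem_Icc
        (OrderIso.inv_apply_eq_self_iff.2 (ho _)) (OrderIso.inv_apply_eq_self_iff.2 (ho' _)) hw
      rw [← hbz]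
      rcases hST _ _ _ hzI e with hS | hT
      · exact Or.inl (mem_iUnion₂.2 ⟨_, hS, hKe _ _ _ e⟩)
      · exact Or.inr (mem_iUnion₂.2 ⟨_, hT, hLe _ _ _ e⟩)
  have hfixed : ∀ {p}, p ∈ globalFixed ψ → p ∈ globalFixed Ψ := fun hp g => hp _
  have hJ : ∀ p q w, IsGap (Function.fixedPoints (ψ (genP4 a))) p q →
      IsGap (Function.fixedPoints (ψ (genP4 d))) p q → w ∈ Ioo p q →
      x w ∈ Ioo p q ∧ y w ∈ Ioo p q ∧ x⁻¹ w ∈ Ioo p q ∧ y⁻¹ w ∈ Ioo p q ∧ x (y w) = y (x w) := by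
    intro p q w ha hd hw
    have eb := h.kopell.apply_endpoints (mem_range d) (mem_range b)
      (commute_genP4_b_d.symm.map ψ) (h.unboundedFixed b) hd
    have ec := h.kopell.apply_endpoints (mem_range a) (mem_range c)
      (commute_genP4_a_c.map ψ) (h.unboundedFixed c) ha
    have hap : ψ (genP4 a) p = p := ha.left_mem
    have haq : ψ (genP4 a) q = q := ha.right_mem
    have hdp : ψ (genP4 d) p = p := hd.left_mem
    have hdq : ψ (genP4 d) q = q := hd.right_mem
    have hxp : x p = p := by rw [hx', OrderIso.inv_apply_eq_self_iff.2 eb.1, hap, eb.1]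
    have hxq : x q = q := by rw [hx', OrderIso.inv_apply_eq_self_iff.2 eb.2, haq, eb.2]
    have hyp : y p = p := by rw [hy', ec.1, hdp, OrderIso.inv_apply_eq_self_iff.2 ec.1]
    have hyq : y q = q := by rw [hy', ec.2, hdq, OrderIso.inv_apply_eq_self_iff.2 ec.2]
    have hxw := OrderIso.apply_mem_Ioo hxp hxq hw
    have hyw := OrderIso.apply_mem_Ioo hyp hyq hw
    refine ⟨hxw, hyw, OrderIso.apply_mem_Ioo (OrderIso.inv_apply_eq_self_iff.2 hxp)
      (OrderIso.inv_apply_eq_self_iff.2 hxq) hw, OrderIso.apply_mem_Ioo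
      (OrderIso.inv_apply_eq_self_iff.2 hyp) (OrderIso.inv_apply_eq_self_iff.2 hyq) hw, ?_⟩
    rw [hx' (y w), hy' (x w), (h.conj_apply_of_common ha hd hyw).1,
      (h.conj_apply_of_common ha hd hxw).2, hx', hy', (h.conj_apply_of_common ha hd hw).1,
      (h.conj_apply_of_common ha hd hw).2]
    exact (commute_genP4_d_a.symm.map ψ).orderIso_apply w
  have hcommute : ∀ p q w, IsGap (Function.fixedPoints (ψ (genP4 a))) p q →
      IsGap (Function.fixedPoints (ψ (genP4 d))) p q → w ∈ Ioo p q → ⁅x, y⁆ w = w := by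
    intro p q w ha hd hw
    have h1 := (hJ p q w ha hd hw).2.2.2.1
    have h2 := (hJ p q _ ha hd h1).2.2.1
    change x (y (x⁻¹ (y⁻¹ w))) = w
    rw [(hJ p q _ ha hd h2).2.2.2.2, RelIso.apply_inv_self, RelIso.apply_inv_self]
  have hu : Ψ conjCommutator = ⁅x, y⁆ := by rw [conjCommutator, map_commutatorElement]
  suffices ∃ u', foldHom u' ≠ 1 ∧ ∀ x ∈ Icc o o', Ψ u' x = x by
    obtain ⟨u', hu', htriv⟩ := this
    exact ⟨conjSubgroupHom u', fun h1 => hu' (foldHom_eq_one h1), htriv⟩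
  -- A point moved by `⁅x, y⁆` has itself, its preimage under `x` or its preimage under `y` in both
  -- supports, which explains the translates of `K₀`. They contain no global fixed point because `c`
  -- moves every point of `K₀`.
  refine exists_trivial_of_compact (ψ := Ψ) (hfixed ho) (hfixed ho')
    (ρ := foldHom) (s := FreeGroup.of 0) (t := FreeGroup.of 1) (u := conjCommutator)
    (K := K₀ ∪ (x '' K₀ ∪ y '' K₀)) ?_ foldHom_conjCommutator_ne_one ?_ ?_ ?_
  · intro z hz1 hz2
    simp only [foldHom, FreeGroup.lift_apply_of, Matrix.cons_val_zero, Matrix.cons_val_one] at hz1 hz2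
    exact FreeGroup.eq_one_of_commute_of (by simp) hz1 hz2
  · exact hK₀compact.union ((hK₀compact.image x.continuous).union (hK₀compact.image y.continuous))
  · have hc : ∀ w ∈ K₀, w ∉ globalFixed Ψ := by
      intro w hw hfix
      have := hfix (FreeGroup.of 1)
      rw [hΨ1] at this
      exact hK₀c w hw this
    rintro _ (hw | ⟨w, hw, rfl⟩ | ⟨w, hw, rfl⟩) hfix
    · exact hc _ hw hfix
    · have := hfix (FreeGroup.of 0)
      rw [← hx] at this
      rw [x.injective this] at hfix
      exact hc w hw hfix
    · have := hfix ((FreeGroup.of 1)⁻¹ * FreeGroup.of 2 * FreeGroup.of 1)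
      rw [← hy] at this
      rw [y.injective this] at hfix
      exact hc w hw hfix
  · intro p hp hne
    rw [hu] at hne
    by_contra hpK
    simp only [mem_union, not_or] at hpK
    obtain ⟨hp0, hpx, hpy⟩ := hpK
    have hInv : ∀ g, (Ψ g)⁻¹ p ∈ Icc o o' := fun g => OrderIso.apply_mem_Icc
      (OrderIso.inv_apply_eq_self_iff.2 (hfixed ho g))
      (OrderIso.inv_apply_eq_self_iff.2 (hfixed ho' g)) hp
    refine hne (OrderIso.commutator_apply_of ?_ ?_ ?_)
    · by_contra! hcon
      rcases hcommon p hp hcon.1 hcon.2 with h1 | ⟨j, k, ha, hd, hpj⟩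
      · exact hp0 h1
      · exact hne (hcommute j k p ha hd hpj)
    · by_contra! hcon
      have hxw : x (x⁻¹ p) ≠ x⁻¹ p := by
        rw [RelIso.apply_inv_self]
        exact fun h1 => hcon.1 (OrderIso.inv_apply_eq_self_iff.1 h1.symm)
      rcases hcommon _ (hInv _) hxw hcon.2 with h1 | ⟨j, k, ha, hd, hpj⟩
      · exact hpx ⟨_, h1, RelIso.apply_inv_self _ _⟩
      · have := (hJ j k _ ha hd hpj).1
        rw [RelIso.apply_inv_self] at this
        exact hne (hcommute j k p ha hd this)
    · by_contra! hcon
      have hyw : y (y⁻¹ p) ≠ y⁻¹ p := by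
        rw [RelIso.apply_inv_self]
        exact fun h1 => hcon.1 (OrderIso.inv_apply_eq_self_iff.1 h1.symm)
      rcases hcommon _ (hInv _) hcon.2 hyw with h1 | ⟨j, k, ha, hd, hpj⟩
      · exact hpy ⟨_, h1, RelIso.apply_inv_self _ _⟩
      · have := (hJ j k _ ha hd hpj).2.1
        rw [RelIso.apply_inv_self] at this
        exact hne (hcommute j k p ha hd this)

/-- A faithful action on `[o, o']` has infinitely many transitions involving pairwise different
components. -/
theorem exists_transitions (h : IsKopellAction ψ) {o o' : ℝ} (ho : o ∈ globalFixed ψ)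
    (ho' : o' ∈ globalFixed ψ) (hψ : ∀ g, (∀ x ∈ Icc o o', ψ g x = x) → g = 1) :
    ∃ (P R : ℕ → ℝ × ℝ) (z : ℕ → ℝ), Function.Injective P ∧ Function.Injective R ∧
      ∀ j, z j ∈ Icc o o' ∧ IsTransition ψ (P j) (R j) (z j) := by
  classical
  -- Greedy choice: the components of finitely many chosen transitions cannot account for all
  -- transitions, so another one exists with both components new.
  obtain ⟨e, he, he'⟩ := exists_seq_of_forall_finset_exists
    (fun e : (ℝ × ℝ) × (ℝ × ℝ) × ℝ => e.2.2 ∈ Icc o o' ∧ IsTransition ψ e.1 e.2.1 e.2.2)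
    (fun e e' => e.1 ≠ e'.1 ∧ e.2.1 ≠ e'.2.1) (by
      intro s _
      by_contra! hcon
      obtain ⟨g, hg, hg'⟩ := h.not_faithful_of_finite ho ho' (s.image fun e => e.1)
        (s.image fun e => e.2.1) (by
          intro P R z hz e
          obtain ⟨x, hx, hx'⟩ := hcon (P, R, z) ⟨hz, e⟩
          by_cases hP : x.1 = P
          · exact Or.inl (Finset.mem_image.2 ⟨x, hx, hP⟩)
          · exact Or.inr (Finset.mem_image.2 ⟨x, hx, hx' hP⟩))
      exact hg (hψ g hg'))
  have hinj : ∀ {α : Type} (f : ℕ → α), (∀ m n, m < n → f m ≠ f n) → Function.Injective f := by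
    intro α f hf m n hmn
    by_contra hne
    rcases lt_or_gt_of_ne hne with hlt | hlt
    · exact hf m n hlt hmn
    · exact hf n m hlt hmn.symm
  exact ⟨fun n => (e n).1, fun n => (e n).2.1, fun n => (e n).2.2,
    hinj _ fun m n hmn => (he' m n hmn).1, hinj _ fun m n hmn => (he' m n hmn).2, he⟩

end IsKopellAction

/-! ### Global fixed points -/

lemma artinP4_closure_range : Subgroup.closure (range genP4) = ⊤ :=
  PresentedGroup.closure_range_of _

lemma mem_globalFixed_of_closure {Γ : Type*} [Group Γ] {ψ : Γ →* (ℝ ≃o ℝ)} {S : Set Γ}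
    (hS : Subgroup.closure S = ⊤) {x : ℝ} (h : ∀ g ∈ S, ψ g x = x) : x ∈ globalFixed ψ := by
  intro g
  have hle : Subgroup.closure S ≤ (MulAction.stabilizer (ℝ ≃o ℝ) x).comap ψ := by
    rw [Subgroup.closure_le]
    exact h
  exact hle (hS ▸ Subgroup.mem_top g)

namespace IsKopellAction

variable {ψ : RightAngledArtinGroup pathP4 →* (ℝ ≃o ℝ)}

open P4Vertex

/-- A faithful action by homeomorphisms commuting with integer translations has a global fixed
point. -/
theorem exists_globalFixed (h : IsKopellAction ψ)
    (hper : ∀ g x (n : ℤ), ψ g (x + n) = ψ g x + n) (hinj : Function.Injective ψ) :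
    ∃ o, o ∈ globalFixed ψ := by
  by_contra! hno
  have hd : ψ (genP4 d) ≠ 1 := fun h1 => genP4_d_ne_one (hinj (h1.trans (map_one ψ).symm))
  obtain ⟨z, hz⟩ : ∃ z, ψ (genP4 d) z ≠ z := by
    by_contra! hall
    exact hd (DFunLike.ext _ _ hall)
  -- An endpoint of a component of `d` is fixed by `a` and `b`, which commute with `d`; hence `⟨a,
  -- b⟩` acts on `[o, o + 1]`.
  obtain ⟨o, o₂, hgap, -⟩ := (h.unboundedFixed d).exists_isGap hz
  have hao := (h.kopell.apply_endpoints (mem_range d) (mem_range a) (commute_genP4_d_a.map ψ)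
    (h.unboundedFixed a) hgap).1
  have hbo := (h.kopell.apply_endpoints (mem_range d) (mem_range b)
    (commute_genP4_b_d.symm.map ψ) (h.unboundedFixed b) hgap).1
  let ι : FreeGroup Bool →* RightAngledArtinGroup pathP4 :=
    FreeGroup.lift fun i => bif i then genP4 a else genP4 b
  have hιa : ι (FreeGroup.of true) = genP4 a := by simp [ι]
  have hιb : ι (FreeGroup.of false) = genP4 b := by simp [ι]
  have ho : o ∈ globalFixed (ψ.comp ι) := by
    refine mem_globalFixed_of_closure (FreeGroup.closure_range_of Bool) ?_
    rintro _ ⟨_ | _, rfl⟩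
    · simpa [hιb] using hbo
    · simpa [hιa] using hao
  have ho' : o + 1 ∈ globalFixed (ψ.comp ι) := fun g => by
    have := hper (ι g) o 1
    rw [Int.cast_one] at this
    rw [MonoidHom.comp_apply, this]
    congr 1
    exact ho g
  set u : FreeGroup Bool := ⁅FreeGroup.of true, FreeGroup.of false⁆ with hu
  have hψu : (ψ.comp ι) u = ⁅ψ (genP4 a), ψ (genP4 b)⁆ := by
    rw [hu, map_commutatorElement, MonoidHom.comp_apply, MonoidHom.comp_apply, hιa, hιb]
  obtain ⟨u', hu', htriv⟩ := exists_trivial_of_compact (ψ := ψ.comp ι) ho ho'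
    (ρ := MonoidHom.id (FreeGroup Bool)) (s := FreeGroup.of true) (t := FreeGroup.of false)
    (fun z hz₁ hz₂ => FreeGroup.eq_one_of_commute_of (by simp) hz₁ hz₂)
    (u := u) (FreeGroup.commutator_of_ne_one (by simp))
    (K := Icc o (o + 1) ∩ closure {x | (ψ.comp ι) u x ≠ x})
    (isCompact_Icc.inter_right isClosed_closure) (by
      rintro p ⟨-, hp⟩ hfix
      have hap : ψ (genP4 a) p = p := by simpa [hιa] using hfix (FreeGroup.of true)
      have hbp : ψ (genP4 b) p = p := by simpa [hιb] using hfix (FreeGroup.of false)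
      -- As `p` is not globally fixed, `c` or `d` moves it, and both commute with `a`. By Kopell
      -- `a`, which fixes `p`, is trivial on the component of `v` around `p`; so `⁅a, b⁆` is trivial
      -- near `p`, although `p` is in the closure of its support.
      obtain ⟨v, hv, hvp⟩ : ∃ v, Commute (genP4 v) (genP4 a) ∧ ψ (genP4 v) p ≠ p := by
        by_contra! hcon
        refine hno p (mem_globalFixed_of_closure artinP4_closure_range ?_)
        rintro _ ⟨v, rfl⟩
        cases v
        · exact hap
        · exact hbp
        · exact hcon c commute_genP4_a_c.symm
        · exact hcon d commute_genP4_d_a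
      obtain ⟨p₁, p₂, hv', hpv⟩ := (h.unboundedFixed v).exists_isGap hvp
      have htriv : ∀ x ∈ Ioo p₁ p₂, ψ (genP4 a) x = x := by
        rcases h.kopell.trivial_or_isGap (mem_range v) (mem_range a) (hv.map ψ)
          (h.unboundedFixed a) hv' with h1 | h1
        · exact h1
        · exact absurd hap (h1.notMem p hpv)
      have hN : Ioo p₁ p₂ ∩ (fun x => (ψ (genP4 b))⁻¹ x) ⁻¹' Ioo p₁ p₂ ∈ nhds p := by
        refine Filter.inter_mem (isOpen_Ioo.mem_nhds hpv) ?_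
        refine ((ψ (genP4 b))⁻¹.continuous.continuousAt).preimage_mem_nhds ?_
        rw [OrderIso.inv_apply_eq_self_iff.2 hbp]
        exact isOpen_Ioo.mem_nhds hpv
      obtain ⟨x, ⟨hx₁, hx₂⟩, hx⟩ := mem_closure_iff_nhds.1 hp _ hN
      refine hx ?_
      rw [hψu]
      exact OrderIso.commutator_apply_of (Or.inl (htriv x hx₁)) (Or.inl (htriv x hx₁))
        (Or.inr (htriv _ hx₂)))
    (fun x hx hne => ⟨hx, subset_closure hne⟩)
  refine hu' ?_
  have h1 : ψ (ι u') = 1 := by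
    ext x
    have hx : x - ⌊x - o⌋ ∈ Icc o (o + 1) := by
      have h1 := Int.floor_le (x - o)
      have h2 := Int.lt_floor_add_one (x - o)
      constructor <;> linarith
    have h2 := htriv _ hx
    have h3 := hper (ι u') (x - ⌊x - o⌋) ⌊x - o⌋
    rw [MonoidHom.comp_apply] at h2
    rw [h2, sub_add_cancel] at h3
    exact h3
  have h2 : ι u' = 1 := hinj (h1.trans (map_one ψ).symm)
  obtain ⟨F, hFa, hFb⟩ := exists_retraction_a_b
  have h3 : F.comp ι = MonoidHom.id _ := by
    ext i
    cases i
    · simp [hιb, hFb]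
    · simp [hιa, hFa]
  rw [← h3, MonoidHom.comp_apply, h2, map_one]

end IsKopellAction

/-! ### Components of the support -/

/-- Here `O = T ∩ Y`, so `O` is connected, relatively open and relatively closed in `Y`. -/
lemma connectedComponentIn_eq_of_isOpen {X : Type*} [TopologicalSpace X] {Y O T : Set X} {x : X}
    (hO : IsOpen O) (hOc : IsPreconnected O) (hOY : O ⊆ Y) (hT : IsClosed T) (hOT : O ⊆ T)
    (hTY : T ∩ Y ⊆ O) (hx : x ∈ O) : connectedComponentIn Y x = O := by
  refine Subset.antisymm ?_ (hOc.subset_connectedComponentIn hx hOY)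
  have hcov : connectedComponentIn Y x ⊆ O ∪ Tᶜ := by
    intro y hy
    by_cases hyT : y ∈ T
    · exact Or.inl (hTY ⟨hyT, connectedComponentIn_subset _ _ hy⟩)
    · exact Or.inr hyT
  refine isPreconnected_connectedComponentIn.subset_left_of_subset_union hO hT.isOpen_compl ?_ hcov
    ⟨x, mem_connectedComponentIn (hOY hx), hx⟩
  exact disjoint_left.2 fun y hy hy' => hy' (hOT hy)

/-- A gap of the fixed point set of a lift `F` of `f` projects to a component of the support
of `f`. -/
lemma image_mem_componentsOf {X : Type*} [TopologicalSpace X] [T2Space X] {f : X → X}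
    {F : ℝ ≃o ℝ} {π : ℝ → X} {o o' p q : ℝ} (hπ : Continuous π) (hinj : InjOn π (Ioo o o'))
    (hopen : IsOpen (π '' Ioo p q)) (hF : ∀ x ∈ Icc o o', π (F x) = f (π x))
    (h : IsGap (Function.fixedPoints F) p q) (hp : o ≤ p) (hq : q ≤ o') :
    π '' Ioo p q ∈ componentsOf (openSupport f) := by
  have hsub : Icc p q ⊆ Icc o o' := Icc_subset_Icc hp hq
  have hsub' : Ioo p q ⊆ Ioo o o' := Ioo_subset_Ioo hp hq
  have hY : π '' Ioo p q ⊆ openSupport f := by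
    rintro _ ⟨x, hx, rfl⟩ hfix
    have h1 := hF x (hsub (Ioo_subset_Icc_self hx))
    rw [show f (π x) = π x from hfix] at h1
    exact h.notMem x hx
      (hinj (hsub' (OrderIso.apply_mem_Ioo h.left_mem h.right_mem hx)) (hsub' hx) h1)
  obtain ⟨x, hx⟩ := exists_between h.lt
  have hx' : x ∈ Ioo p q := hx
  refine ⟨π x, hY ⟨x, hx', rfl⟩, (connectedComponentIn_eq_of_isOpen hopen
    (isPreconnected_Ioo.image π hπ.continuousOn) hY (T := π '' Icc p q)
    (isCompact_Icc.image hπ).isClosed (image_mono Ioo_subset_Icc_self) ?_ ⟨x, hx', rfl⟩).symm⟩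
  rintro _ ⟨⟨y, hy, rfl⟩, hyY⟩
  have hfix : ∀ y ∈ Icc o o', F y = y → f (π y) = π y := fun y hy hFy => by rw [← hF y hy, hFy]
  refine ⟨y, ⟨hy.1.lt_of_ne ?_, hy.2.lt_of_ne ?_⟩, rfl⟩
  · rintro rfl
    exact hyY (hfix _ (hsub hy) h.left_mem)
  · rintro rfl
    exact hyY (hfix _ (hsub hy) h.right_mem)

open P4Vertex in
/-- Transitions of an action on the line yield intersecting components in the quotient space. -/
theorem IsKopellAction.exists_components {ψ : RightAngledArtinGroup pathP4 →* (ℝ ≃o ℝ)}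
    (h : IsKopellAction ψ) {o o' : ℝ} (ho : o ∈ globalFixed ψ) (ho' : o' ∈ globalFixed ψ)
    (hψ : ∀ g, (∀ x ∈ Icc o o', ψ g x = x) → g = 1) {X : Type*} [TopologicalSpace X] [T2Space X]
    {φ : RightAngledArtinGroup pathP4 → X → X} {π : ℝ → X} (hπ : Continuous π)
    (hinj : InjOn π (Ioo o o')) (hopen : ∀ p q, o ≤ p → q ≤ o' → IsOpen (π '' Ioo p q))
    (hlift : ∀ g, ∀ x ∈ Icc o o', π (ψ g x) = φ g (π x)) :
    ∃ Ia Id : ℕ → Set X, (∀ j, Ia j ∈ componentsOf (openSupport (φ (genP4 a)))) ∧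
      (∀ j, Id j ∈ componentsOf (openSupport (φ (genP4 d)))) ∧
      Function.Injective Ia ∧ Function.Injective Id ∧
      ∀ j, Ia j ≠ Id j ∧ ((φ (genP4 c * genP4 b) '' Ia j) ∩ Id j).Nonempty := by
  obtain ⟨P, R, z, hP, hR, hz⟩ := h.exists_transitions ho ho' hψ
  -- Global fixed points belong to no component, so a component meeting `[o, o']` lies inside it,
  -- where `π` is injective up to the endpoints.
  have hbound : ∀ {g : RightAngledArtinGroup pathP4} {Q : ℝ × ℝ} {x : ℝ},
      IsGap (Function.fixedPoints (ψ g)) Q.1 Q.2 → x ∈ Icc o o' → x ∈ Ioo Q.1 Q.2 →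
      o ≤ Q.1 ∧ Q.2 ≤ o' := fun hQ hx hxQ =>
    ⟨hQ.left_le (ho _) hxQ hx.1, hQ.le_right (ho' _) hxQ hx.2⟩
  have hbP := fun j => hbound (hz j).2.isGap_a (hz j).1 (hz j).2.mem_a
  have hbR := fun j => hbound (hz j).2.isGap_d
    (OrderIso.apply_mem_Icc (ho _) (ho' _) (OrderIso.apply_mem_Icc (ho _) (ho' _) (hz j).1))
    (hz j).2.mem_d
  have hmeet : ∀ {p q r s : ℝ}, o ≤ p → q ≤ o' → o ≤ r → s ≤ o' → p < q →
      π '' Ioo p q = π '' Ioo r s → ∃ x, x ∈ Ioo p q ∧ x ∈ Ioo r s := by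
    intro p q r s hp hq hr hs hpq heq
    obtain ⟨x, hx⟩ := exists_between hpq
    have hx' : x ∈ Ioo p q := hx
    obtain ⟨y, hy, hyx⟩ := heq ▸ mem_image_of_mem π hx'
    have := hinj (Ioo_subset_Ioo hr hs hy) (Ioo_subset_Ioo hp hq hx') hyx
    exact ⟨x, hx', this ▸ hy⟩
  refine ⟨fun j => π '' Ioo (P j).1 (P j).2, fun j => π '' Ioo (R j).1 (R j).2, ?_, ?_, ?_, ?_, ?_⟩
  · exact fun j => image_mem_componentsOf hπ hinj (hopen _ _ (hbP j).1 (hbP j).2) (hlift _)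
      (hz j).2.isGap_a (hbP j).1 (hbP j).2
  · exact fun j => image_mem_componentsOf hπ hinj (hopen _ _ (hbR j).1 (hbR j).2) (hlift _)
      (hz j).2.isGap_d (hbR j).1 (hbR j).2
  · intro i j hij
    obtain ⟨x, hx, hx'⟩ := hmeet (hbP i).1 (hbP i).2 (hbP j).1 (hbP j).2 (hz i).2.isGap_a.lt hij
    have := (hz i).2.isGap_a.eq_of_mem (hz j).2.isGap_a hx hx'
    exact hP (Prod.ext this.1 this.2)
  · intro i j hij
    obtain ⟨x, hx, hx'⟩ := hmeet (hbR i).1 (hbR i).2 (hbR j).1 (hbR j).2 (hz i).2.isGap_d.lt hij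
    have := (hz i).2.isGap_d.eq_of_mem (hz j).2.isGap_d hx hx'
    exact hR (Prod.ext this.1 this.2)
  · intro j
    refine ⟨fun heq => ?_, π (ψ (genP4 c) (ψ (genP4 b) (z j))), ⟨π (z j), ⟨z j, (hz j).2.mem_a, rfl⟩,
      ?_⟩, ⟨_, (hz j).2.mem_d, rfl⟩⟩
    · obtain ⟨x, hx, hx'⟩ := hmeet (hbP j).1 (hbP j).2 (hbR j).1 (hbR j).2 (hz j).2.isGap_a.lt heq
      have := h.kopell.eq_of_mem (mem_range a) (mem_range d)
        (commute_genP4_d_a.symm.map ψ) (hz j).2.isGap_a (hz j).2.isGap_d hx hx'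
      exact (hz j).2.ne (Prod.ext this.1 this.2)
    · rw [← hlift _ _ (hz j).1, map_mul]
      rfl

/-! ### Regularity of lifts -/

/-- The derivative of `F` is nonnegative by monotonicity and nonzero by the chain rule for `G ∘ F =
id`. -/
lemma isRegularOn_of_diffeo {f : ℝ ≃o ℝ} {F G : ℝ → ℝ} {s : Set ℝ} {p q : ℝ} (hpq : p < q)
    (hs : UniqueDiffOn ℝ s) (hsub : Icc p q ⊆ s) (hF : ContDiffOn ℝ 1 F s)
    (hG : ContDiffOn ℝ 1 G s) (hFs : MapsTo F s s) (hGF : ∀ x ∈ s, G (F x) = x)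
    (hmono : MonotoneOn F s) (hbv : BoundedVariationOn (derivWithin F s) (Icc p q))
    (hf : EqOn f F (Icc p q)) : IsRegularOn f p q := by
  have hderiv : EqOn (derivWithin f (Icc p q)) (derivWithin F s) (Icc p q) := by
    intro x hx
    rw [derivWithin_congr hf (hf hx)]
    exact derivWithin_subset hsub (uniqueDiffOn_Icc hpq x hx)
      (hF.differentiableOn one_ne_zero x (hsub hx))
  refine ⟨(hF.mono hsub).congr hf, fun x hx => ?_, ?_⟩
  · rw [hderiv hx]
    have hxs := hsub hx
    refine (hmono.derivWithin_nonneg).lt_of_ne fun h0 => ?_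
    have h1 : derivWithin G s (F x) * derivWithin F s x = 1 := by
      rw [← derivWithin_comp x (hG.differentiableOn one_ne_zero _ (hFs hxs))
        (hF.differentiableOn one_ne_zero _ hxs) hFs,
        show derivWithin (G ∘ F) s x = derivWithin id s x from
          derivWithin_congr (fun y hy => hGF y hy) (hGF x hxs)]
      exact derivWithin_id x s (hs x hxs)
    rw [← h0, mul_zero] at h1
    exact zero_ne_one h1
  · unfold BoundedVariationOn
    rw [eVariationOn.congr hderiv]
    exact hbv

/-! ### The interval -/

/-- An increasing homeomorphism of `[0, 1]`, extended by the identity. -/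
noncomputable def extendById (f : unitInterval → unitInterval) (x : ℝ) : ℝ :=
  open scoped Classical in if h : x ∈ Icc (0 : ℝ) 1 then f ⟨x, h⟩ else x

lemma extendById_of_mem (f : unitInterval → unitInterval) {x : ℝ} (hx : x ∈ Icc (0 : ℝ) 1) :
    extendById f x = f ⟨x, hx⟩ := dif_pos hx

lemma extendById_of_notMem (f : unitInterval → unitInterval) {x : ℝ} (hx : x ∉ Icc (0 : ℝ) 1) :
    extendById f x = x := dif_neg hx

lemma extendById_comp (f g : unitInterval → unitInterval) (x : ℝ) :
    extendById (f ∘ g) x = extendById f (extendById g x) := by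
  by_cases hx : x ∈ Icc (0 : ℝ) 1
  · rw [extendById_of_mem _ hx, extendById_of_mem g hx, extendById_of_mem f (g _).2]
    rfl
  · rw [extendById_of_notMem _ hx, extendById_of_notMem g hx, extendById_of_notMem f hx]

lemma extendById_id (x : ℝ) : extendById id x = x := by
  by_cases hx : x ∈ Icc (0 : ℝ) 1
  · rw [extendById_of_mem _ hx]
    rfl
  · rw [extendById_of_notMem _ hx]

lemma extendById_strictMono {f : unitInterval → unitInterval} (hf : StrictMono f) :
    StrictMono (extendById f) := by
  intro x y hxy
  by_cases hx : x ∈ Icc (0 : ℝ) 1 <;> by_cases hy : y ∈ Icc (0 : ℝ) 1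
  · rw [extendById_of_mem _ hx, extendById_of_mem _ hy]
    exact hf (show (⟨x, hx⟩ : unitInterval) < ⟨y, hy⟩ from hxy)
  · rw [extendById_of_mem _ hx, extendById_of_notMem _ hy]
    have : 1 < y := by
      by_contra! h
      exact hy ⟨hx.1.trans hxy.le, h⟩
    exact (f _).2.2.trans_lt this
  · rw [extendById_of_notMem _ hx, extendById_of_mem _ hy]
    have : x < 0 := by
      by_contra! h
      exact hx ⟨h, hxy.le.trans hy.2⟩
    exact this.trans_le (f _).2.1
  · rwa [extendById_of_notMem _ hx, extendById_of_notMem _ hy]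

/-- Extension by the identity, as an action of the diffeomorphism group on the line. -/
noncomputable def extendByIdHom :
    ConnectedOneManifold.DiffBV ConnectedOneManifold.interval →* (ℝ ≃o ℝ) where
  toFun f := StrictMono.orderIsoOfRightInverse
    (extendById (f.1 : unitInterval ≃ₜ unitInterval))
    (extendById_strictMono (show IsIntervalDiffBV f.1 from f.2).strictMono)
    (extendById (f.1 : unitInterval ≃ₜ unitInterval).symm) (fun x => by
      rw [← extendById_comp, Homeomorph.self_comp_symm, extendById_id])
  map_one' := by
    ext x
    exact extendById_id x
  map_mul' f g := by
    ext x
    exact extendById_comp _ _ x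

lemma extendByIdHom_apply (f : ConnectedOneManifold.DiffBV ConnectedOneManifold.interval) (x : ℝ) :
    extendByIdHom f x = extendById (f.1 : unitInterval ≃ₜ unitInterval) x := rfl

lemma extendByIdHom_zero (f : ConnectedOneManifold.DiffBV ConnectedOneManifold.interval) :
    extendByIdHom f 0 = 0 := by
  have key : ∀ f : ConnectedOneManifold.DiffBV ConnectedOneManifold.interval,
      0 ≤ extendByIdHom f 0 := fun f => by
    rw [extendByIdHom_apply, extendById_of_mem _ (left_mem_Icc.2 zero_le_one)]
    exact unitInterval.nonneg _
  refine le_antisymm ?_ (key f)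
  have := key f⁻¹
  rwa [map_inv, OrderIso.le_inv_apply_iff] at this

lemma extendByIdHom_one (f : ConnectedOneManifold.DiffBV ConnectedOneManifold.interval) :
    extendByIdHom f 1 = 1 := by
  have key : ∀ f : ConnectedOneManifold.DiffBV ConnectedOneManifold.interval,
      extendByIdHom f 1 ≤ 1 := fun f => by
    rw [extendByIdHom_apply, extendById_of_mem _ (right_mem_Icc.2 zero_le_one)]
    exact unitInterval.le_one _
  refine le_antisymm (key f) ?_
  have := key f⁻¹
  rwa [map_inv, OrderIso.inv_apply_le_iff] at this

lemma extendByIdHom_of_notMem (f : ConnectedOneManifold.DiffBV ConnectedOneManifold.interval)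
    {x : ℝ} (hx : x ∉ Ioo (0 : ℝ) 1) : extendByIdHom f x = x := by
  by_cases h : x ∈ Icc (0 : ℝ) 1
  · rcases h.1.eq_or_lt with rfl | h0
    · exact extendByIdHom_zero f
    · rcases h.2.eq_or_lt with rfl | h1
      · exact extendByIdHom_one f
      · exact absurd ⟨h0, h1⟩ hx
  · exact extendById_of_notMem _ h

/-- All points outside `(0, 1)` are fixed. This gives unbounded fixed sets and keeps every gap in
`[0, 1]`, so smoothness of the extension across `0` and `1` is not needed. -/
lemma isKopellAction_interval
    (φ : RightAngledArtinGroup pathP4 →* ConnectedOneManifold.DiffBV ConnectedOneManifold.interval) :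
    IsKopellAction (extendByIdHom.comp φ) := by
  constructor
  · refine kopellProperty_of_isRegularOn ?_
    rintro _ ⟨f, rfl⟩ _ ⟨g, rfl⟩ p q hgap
    have hsub : Icc p q ⊆ Icc 0 1 := by
      obtain ⟨x, hx, hx'⟩ := exists_between hgap.lt
      have hxI : x ∈ Ioo (0 : ℝ) 1 := by
        by_contra h
        exact hgap.notMem x ⟨hx, hx'⟩ (extendByIdHom_of_notMem _ h)
      exact Icc_subset_Icc (hgap.left_le (extendByIdHom_zero _) ⟨hx, hx'⟩ hxI.1.le)
        (hgap.le_right (extendByIdHom_one _) ⟨hx, hx'⟩ hxI.2.le)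
    have hf : IsIntervalDiffBV (φ f).1 := (φ f).2
    refine isRegularOn_of_diffeo hgap.lt uniqueDiffOn_Icc_zero_one hsub hf.contDiff
      hf.contDiff_symm (intervalFun_mapsTo _) ?_ (intervalFun_monotoneOn hf.strictMono.monotone)
      (hf.bv.mono hsub) ?_
    · intro x hx
      have := intervalFun_comp ((φ f).1 : unitInterval ≃ₜ unitInterval).symm
        ((φ f).1 : unitInterval ≃ₜ unitInterval) hx
      rw [Function.comp_apply] at this
      rw [← this, intervalFun_of_mem _ hx]
      simp
    · intro x hx
      rw [intervalFun_of_mem _ (hsub hx)]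
      exact extendById_of_mem _ (hsub hx)
  · intro v
    have h : ∀ x : ℝ, x ∉ Ioo (0 : ℝ) 1 → extendByIdHom.comp φ (genP4 v) x = x := fun x hx =>
      extendByIdHom_of_notMem _ hx
    exact ⟨fun x => ⟨min x 0, min_le_left _ _, h _ fun h => h.1.not_ge (min_le_right _ _)⟩,
      fun x => ⟨max x 1, le_max_left _ _, h _ fun h => h.2.not_ge (le_max_right _ _)⟩⟩

/-! ### The circle -/

/-- Two lifts of the same circle homeomorphism differ by an integer. -/
lemma exists_int_of_lifts {F G : CircleDeg1Liftˣ}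
    (h : ∀ x : ℝ, ((F x : ℝ) : UnitAddCircle) = (G x : ℝ)) : ∃ n : ℤ, ∀ x, F x = G x + n := by
  have hint : ∀ x : ℝ, ∃ n : ℤ, (n : ℝ) = F x - G x := by
    intro x
    have h1 : ((F x - G x : ℝ) : UnitAddCircle) = 0 := by
      rw [AddCircle.coe_sub, h x, sub_self]
    obtain ⟨n, hn⟩ := (AddCircle.coe_eq_zero_iff 1).1 h1
    exact ⟨n, by simpa using hn⟩
  have hc : Continuous fun x : ℝ => F x - G x :=
    (CircleDeg1Lift.toOrderIso F).continuous.sub (CircleDeg1Lift.toOrderIso G).continuous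
  obtain ⟨_, ⟨n, rfl⟩, hn⟩ := isPreconnected_univ.eqOn_const_of_mapsTo
    (T := range ((↑) : ℤ → ℝ)) (Int.isClosedEmbedding_coe_real.isInducing.isDiscrete_range)
    hc.continuousOn (fun x _ => hint x) (range_nonempty _)
  exact ⟨n, fun x => by linarith [hn (mem_univ x), show F x - G x = n from hn (mem_univ x)]⟩

/-- `F` is a lift of the circle homeomorphism `f`. -/
def IsLift (F : CircleDeg1Liftˣ) (f : UnitAddCircle ≃ₜ UnitAddCircle) : Prop :=
  ∀ x : ℝ, ((F x : ℝ) : UnitAddCircle) = f (x : UnitAddCircle)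

lemma IsLift.mul {F G : CircleDeg1Liftˣ} {f g : UnitAddCircle ≃ₜ UnitAddCircle} (hF : IsLift F f)
    (hG : IsLift G g) : IsLift (F * G) (f * g) := by
  intro x
  rw [Homeomorph.mul_apply, ← hG, ← hF]
  rfl

lemma IsLift.inv {F : CircleDeg1Liftˣ} {f : UnitAddCircle ≃ₜ UnitAddCircle} (hF : IsLift F f) :
    IsLift F⁻¹ f⁻¹ := by
  intro x
  rw [Homeomorph.inv_apply, Homeomorph.eq_symm_apply, ← hF, CircleDeg1Lift.units_apply_inv_apply]

/-- A circle diffeomorphism with a fixed point has a lift with a fixed point. -/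
lemma exists_lift_with_fixedPoint {f : UnitAddCircle ≃ₜ UnitAddCircle} (hf : IsCircleDiffBV f)
    (hfix : (Function.fixedPoints f).Nonempty) : ∃ F, IsLift F f ∧ ∃ t : ℝ, F t = t := by
  obtain ⟨F, hF, -⟩ := hf
  obtain ⟨y, hy⟩ := hfix
  obtain ⟨t, rfl⟩ := QuotientAddGroup.mk_surjective y
  have h1 : ((F t - t : ℝ) : UnitAddCircle) = 0 := by
    rw [AddCircle.coe_sub, hF t]
    exact sub_eq_zero.2 hy
  obtain ⟨n, hn⟩ := (AddCircle.coe_eq_zero_iff 1).1 h1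
  have hn' : F t - t = n := by simpa using hn.symm
  refine ⟨CircleDeg1Lift.translate (Multiplicative.ofAdd (-(n : ℝ))) * F, fun x => ?_, t, ?_⟩
  · have : ((CircleDeg1Lift.translate (Multiplicative.ofAdd (-(n : ℝ))) * F :
        CircleDeg1Liftˣ) x : ℝ) = -(n : ℝ) + F x := CircleDeg1Lift.translate_apply _ _
    rw [this, ← hF x, AddCircle.coe_add]
    have h0 : ((-(n : ℝ) : ℝ) : UnitAddCircle) = 0 :=
      (AddCircle.coe_eq_zero_iff 1).2 ⟨-n, by simp⟩
    rw [h0, zero_add]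
  · have : ((CircleDeg1Lift.translate (Multiplicative.ofAdd (-(n : ℝ))) * F :
        CircleDeg1Liftˣ) t : ℝ) = -(n : ℝ) + F t := CircleDeg1Lift.translate_apply _ _
    rw [this]
    linarith

/-- Lifts with fixed points of commuting homeomorphisms commute. -/
lemma commute_of_isLift {F G : CircleDeg1Liftˣ} {f g : UnitAddCircle ≃ₜ UnitAddCircle}
    (hF : IsLift F f) (hG : IsLift G g) (hfg : Commute f g) {t : ℝ} (ht : F t = t) :
    Commute F G := by
  -- Both `G F G⁻¹` and `F` lift `f`, so they differ by an integer `n`. Translation numbers are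
  -- conjugation invariant and vanish for a map with a fixed point, so `n = 0`.
  obtain ⟨n, hn⟩ := exists_int_of_lifts (F := G * F * G⁻¹) (G := F) fun x => by
    rw [(hG.mul hF).mul hG.inv x, hF x, ← hfg.eq, mul_inv_cancel_right]
  have h0 : CircleDeg1Lift.translationNumber (F : CircleDeg1Lift) = ((0 : ℤ) : ℝ) :=
    CircleDeg1Lift.translationNumber_of_eq_add_int _ (x := t) (by simpa using ht)
  have h1 : CircleDeg1Lift.translationNumber ((G * F * G⁻¹ : CircleDeg1Liftˣ) : CircleDeg1Lift)
      = n := CircleDeg1Lift.translationNumber_of_eq_add_int _ (x := t) (by rw [hn t, ht])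
  rw [Units.val_mul, Units.val_mul, CircleDeg1Lift.translationNumber_conj_eq, h0] at h1
  have hn0 : n = 0 := by exact_mod_cast h1.symm
  have h2 : G * F * G⁻¹ = F := by
    ext x
    simpa [hn0] using hn x
  exact (mul_inv_eq_iff_eq_mul.1 h2).symm

/-- Choosing for each generator a lift with a fixed point makes the lifts satisfy the commutation
relations exactly, not just up to integer translation. -/
lemma exists_lift_hom
    (φ : RightAngledArtinGroup pathP4 →* ConnectedOneManifold.DiffBV ConnectedOneManifold.circle)
    (hfix : ∀ v, (Function.fixedPoints
      ((φ (genP4 v)).1 : UnitAddCircle ≃ₜ UnitAddCircle)).Nonempty) :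
    ∃ Φ : RightAngledArtinGroup pathP4 →* CircleDeg1Liftˣ, (∀ g, IsLift (Φ g) (φ g).1) ∧
      ∀ v, ∃ t : ℝ, Φ (genP4 v) t = t := by
  choose F hF t ht using fun v => exists_lift_with_fixedPoint (φ (genP4 v)).2 (hfix v)
  have hcomm : ∀ {v w}, Commute (genP4 v) (genP4 w) → Commute (F v) (F w) := fun {v w} h =>
    commute_of_isLift (hF v) (hF w)
      (h.map ((ConnectedOneManifold.DiffBV ConnectedOneManifold.circle).subtype.comp φ)) (ht v)
  obtain ⟨Φ, hΦ⟩ := exists_hom_artinP4 F (hcomm commute_genP4_b_d) (hcomm commute_genP4_d_a)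
    (hcomm commute_genP4_a_c)
  refine ⟨Φ, fun g => ?_, fun v => ⟨t v, by rw [hΦ]; exact ht v⟩⟩
  have hg : g ∈ Subgroup.closure (range genP4) := by
    rw [artinP4_closure_range]
    exact Subgroup.mem_top g
  induction hg using Subgroup.closure_induction with
  | mem x hx =>
    obtain ⟨v, rfl⟩ := hx
    rw [hΦ]
    exact hF v
  | one =>
    rw [map_one, map_one]
    exact fun x => rfl
  | mul x y _ _ hx hy =>
    rw [map_mul, map_mul]
    exact hx.mul hy
  | inv x _ hx =>
    rw [map_inv, map_inv]
    exact hx.inv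

lemma isRegularOn_of_isLift {F : CircleDeg1Liftˣ} {f : UnitAddCircle ≃ₜ UnitAddCircle}
    (hF : IsLift F f) (hf : IsCircleDiffBV f) {p q : ℝ} (hpq : p < q) (hq : q ≤ p + 1) :
    IsRegularOn (CircleDeg1Lift.toOrderIso F) p q := by
  obtain ⟨G, hG, hG₁, hG₂, hG₃⟩ := hf
  obtain ⟨n, hn⟩ := exists_int_of_lifts (F := F) (G := G) fun x => by rw [hF x, hG x]
  have hd : derivWithin (fun x : ℝ => G x + (n : ℝ)) univ = deriv G := by
    rw [derivWithin_univ]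
    funext x
    exact deriv_add_const _
  refine isRegularOn_of_diffeo (s := univ) (F := fun x => G x + (n : ℝ))
    (G := fun x => (G⁻¹ : CircleDeg1Liftˣ) (x - n)) hpq uniqueDiffOn_univ (subset_univ _)
    (hG₁.add contDiff_const).contDiffOn (hG₂.comp (contDiff_id.sub contDiff_const)).contDiffOn
    (mapsTo_univ _ _) ?_ ?_ ?_ ?_
  · intro x _
    simp
  · intro x _ y _ hxy
    have := G.val.monotone hxy
    simpa using this
  · rw [hd]
    exact (bv_of_periodic G.val.deriv_periodic hG₃ p).mono (Icc_subset_Icc_right hq)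
  · intro x _
    exact hn x

lemma isKopellAction_circle
    {φ : RightAngledArtinGroup pathP4 →* ConnectedOneManifold.DiffBV ConnectedOneManifold.circle}
    {Φ : RightAngledArtinGroup pathP4 →* CircleDeg1Liftˣ} (hΦ : ∀ g, IsLift (Φ g) (φ g).1)
    (hfix : ∀ v, ∃ t : ℝ, Φ (genP4 v) t = t) :
    IsKopellAction (CircleDeg1Lift.toOrderIso.comp Φ) := by
  constructor
  · refine kopellProperty_of_isRegularOn ?_
    rintro _ ⟨f, rfl⟩ _ ⟨g, rfl⟩ p q hgap
    refine isRegularOn_of_isLift (hΦ f) (φ f).2 hgap.lt ?_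
    have h1 : Φ g p = p := hgap.left_mem
    -- A gap longer than one period would contain the fixed point `p + 1`.
    by_contra! hlt
    refine hgap.notMem (p + 1) ⟨lt_add_one p, hlt⟩ ?_
    change Φ g (p + 1) = p + 1
    rw [CircleDeg1Lift.map_add_one, h1]
  · intro v
    obtain ⟨t, ht⟩ := hfix v
    have h : ∀ n : ℤ, CircleDeg1Lift.toOrderIso.comp Φ (genP4 v) (t + n) = t + n := fun n => by
      change Φ (genP4 v) (t + n) = t + n
      rw [CircleDeg1Lift.map_add_int, ht]
    constructor
    · intro x
      refine ⟨t + ⌊x - t⌋, ?_, h _⟩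
      linarith [Int.floor_le (x - t)]
    · intro x
      refine ⟨t + ⌈x - t⌉, ?_, h _⟩
      linarith [Int.le_ceil (x - t)]

/-! ### The main theorem -/

theorem proposition1p6 (M : ConnectedOneManifold)
    (φ : RightAngledArtinGroup pathP4 →* M.DiffBV)
    (hφ : Function.Injective φ)
    (hfix : ∀ v : P4Vertex,
      (Function.fixedPoints (φ (genP4 v) : M.Carrier ≃ₜ M.Carrier)).Nonempty) :
    ∃ Ia Id : ℕ → Set M.Carrier,
      (∀ j, Ia j ∈ componentsOf
        (openSupport (φ (genP4 P4Vertex.a) : M.Carrier ≃ₜ M.Carrier))) ∧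
      (∀ j, Id j ∈ componentsOf
        (openSupport (φ (genP4 P4Vertex.d) : M.Carrier ≃ₜ M.Carrier))) ∧
      Function.Injective Ia ∧ Function.Injective Id ∧
      ∀ j, Ia j ≠ Id j ∧
        (((φ (genP4 P4Vertex.c * genP4 P4Vertex.b) : M.Carrier ≃ₜ M.Carrier) '' Ia j) ∩
          Id j).Nonempty := by
  cases M with
  | interval =>
    have hmaps : ∀ (g : RightAngledArtinGroup pathP4) (x : ℝ) (hx : x ∈ Icc (0 : ℝ) 1),
        extendByIdHom.comp φ g x = ((φ g).1 : unitInterval ≃ₜ unitInterval) ⟨x, hx⟩ :=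
      fun g x hx => extendById_of_mem _ hx
    refine (isKopellAction_interval φ).exists_components (o := 0) (o' := 1)
      (fun g => extendByIdHom_zero _) (fun g => extendByIdHom_one _) ?_ (X := unitInterval)
      (φ := fun g => ((φ g).1 : unitInterval ≃ₜ unitInterval))
      (π := projIcc 0 1 zero_le_one) continuous_projIcc ?_ ?_ ?_
    · intro g hg
      refine hφ ?_
      rw [map_one]
      refine Subtype.ext (Homeomorph.ext fun (x : unitInterval) => Subtype.ext ?_)
      have := hmaps g x x.2
      rw [hg _ x.2] at this
      exact this.symm
    · intro x hx y hy hxy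
      have := congrArg Subtype.val hxy
      rwa [projIcc_of_mem _ (Ioo_subset_Icc_self hx), projIcc_of_mem _ (Ioo_subset_Icc_self hy)]
        at this
    · intro p q hp hq
      have : projIcc (0 : ℝ) 1 zero_le_one '' Ioo p q = Subtype.val ⁻¹' Ioo p q := by
        ext y
        constructor
        · rintro ⟨x, hx, rfl⟩
          rw [projIcc_of_mem _ ⟨hp.trans hx.1.le, hx.2.le.trans hq⟩]
          exact hx
        · intro hy
          exact ⟨y, hy, projIcc_val _ y⟩
      rw [this]
      exact isOpen_Ioo.preimage continuous_subtype_val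
    · intro g x hx
      rw [hmaps g x hx, projIcc_val, projIcc_of_mem _ hx]
  | circle =>
    obtain ⟨Φ, hΦ, ht⟩ := exists_lift_hom φ hfix
    have hK := isKopellAction_circle hΦ ht
    have hfaithful : ∀ g, (∀ x : ℝ, Φ g x = x) → g = 1 := by
      intro g hg
      refine hφ ?_
      rw [map_one]
      refine Subtype.ext (Homeomorph.ext fun (x : UnitAddCircle) => ?_)
      obtain ⟨t, rfl⟩ := QuotientAddGroup.mk_surjective x
      exact (hΦ g t).symm.trans (by rw [hg t]; rfl)
    -- The circle is cut open at the image of a global fixed point, making `[o, o + 1]` an invariant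
    -- fundamental domain.
    obtain ⟨o, ho⟩ := hK.exists_globalFixed (fun g x n => (Φ g).val.map_add_int x n)
      ((injective_iff_map_eq_one _).2 fun g hg => hfaithful g fun x => DFunLike.congr_fun hg x)
    refine hK.exists_components (o := o) (o' := o + 1) ho ?_ ?_ (X := UnitAddCircle)
      (φ := fun g => ((φ g).1 : UnitAddCircle ≃ₜ UnitAddCircle))
      (π := fun x => (x : UnitAddCircle)) (AddCircle.continuous_mk' 1) ?_ ?_ ?_
    · intro g
      have h1 := (Φ g).val.map_add_one o
      exact h1.trans (congrArg (· + 1) (ho g))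
    · intro g hg
      refine hfaithful g fun x => ?_
      have hx : x - ⌊x - o⌋ ∈ Icc o (o + 1) := by
        have h1 := Int.floor_le (x - o)
        have h2 := Int.lt_floor_add_one (x - o)
        constructor <;> linarith
      have h3 := (Φ g).val.map_add_int (x - ⌊x - o⌋) ⌊x - o⌋
      rw [show (Φ g : CircleDeg1Lift) (x - ⌊x - o⌋) = x - ⌊x - o⌋ from hg _ hx,
        sub_add_cancel] at h3
      exact h3
    · intro x hx y hy hxy
      exact (AddCircle.coe_eq_coe_iff_of_mem_Ico (p := (1 : ℝ)) (a := o) (Ioo_subset_Ico_self hx)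
        (Ioo_subset_Ico_self hy)).1 hxy
    · intro p q _ _
      exact QuotientAddGroup.isOpenMap_coe _ isOpen_Ioo
    · intro g x _
      exact hΦ g x
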